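/- **Setting.** Let $\mathcal B$ be a unital $C^*$-algebra, $\alpha$ a $*$-automorphism of $\mathcal B$, $\mathcal C$ a von Neumann algebra acting on a Hilbert space $\mathcal H$, and $\Omega$ a set. A Hilbert $\mathcal C$-module $E$ (right module, inner product linear in the second variable) is a *von Neumann $\mathcal C$-module* if $\{h\mapsto x\otimes h : x\in E\}$ is strongly closed in $\mathcal B(\mathcal H, E\otimes\mathcal H)$, where $E\otimes\mathcal H$ is the interior tensor product. An *$\alpha$-CPD-kernel* over $\Omega$ from $\mathcal B$ to $\mathcal C$ is a family $\mathfrak K=(\mathfrak K^{\sigma,\sigma'})_{\sigma,\sigma'\in\Omega}$ of bounded linear maps $\mathcal B\to\mathcal C$ with $\mathfrak K^{\sigma,\sigma'}(b^*)=\mathfrak K^{\sigma',\sigma}(b)^*$ and $\mathfrak K^{\sigma,\sigma'}(\alpha(b))=\mathfrak K^{\sigma,\sigma'}(b)$, with $\sum_{i,j}c_i^*\mathfrak K^{\sigma_i,\sigma_j}(\alpha(b_i)^*b_j)c_j\ge 0$ for all finite families $\sigma_i\in\Omega$, $b_i\in\mathcal B$, $c_i\in\mathcal C$, and such that for each $b\in\mathcal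 B$ there is $M(b)>0$ with $$\Big\|\sum_{i,j}c_i^*\mathfrak K^{\sigma_i,\sigma_j}(\alpha(b_i^*b^*)bb_j)c_j\Big\|\le M(b)\Big\|\sum_{i,j}c_i^*\mathfrak K^{\sigma_i,\sigma_j}(\alpha(b_i^*)b_j)c_j\Big\|$$ for all such families. Write $\mathcal K^\alpha_\Omega(\mathcal B,\mathcal C)$ for the set of these kernels. An *S-correspondence* from $\mathcal B$ to $\mathcal C$ is a Hilbert $\mathcal C$-module $\mathcal F$ with a unitary $U$ and a unital algebra homomorphism $\pi$ from $\mathcal B$ to the adjointable operators on $\mathcal F$ such that $\pi(b^*)=U^*\pi(b)^*U$ for all $b$; write $bx=\pi(b)x$. For a kernel $\mathfrak K$ let $\mathcal S(\mathcal F,\mathfrak K)$ be the set of maps $\mathfrak i:\Omega\to\mathcal F$ with $$\mathfrak K^{\sigma,\sigma'}(b)=\langle\mathfrak i(\sigma),b\,\mathfrak i(\sigma')\rangle=\langle\alpha(b^*)\mathfrak i(\sigma),\mathfrak i(\sigma')\rangle,\qquad U(b\,\mathfrak i(\sigma))=\alpha(b)\,\mathfrak i(\sigma)$$ for all $\sigma,\sigma'\in\Omega$,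 $b\in\mathcal B$. $\mathcal F$ is a *common S-correspondence* for $\mathfrak K_1,\mathfrak K_2$ if $\mathcal S(\mathcal F,\mathfrak K_1)$ and $\mathcal S(\mathcal F,\mathfrak K_2)$ are non-empty. Put $$\beta_{\mathcal F}(\mathfrak K_1,\mathfrak K_2)=\inf\{\|\mathfrak i_1(\sigma)-\mathfrak i_2(\sigma)\|:\mathfrak i_m\in\mathcal S(\mathcal F,\mathfrak K_m)\ (m=1,2),\ \sigma\in\Omega\},\qquad \beta(\mathfrak K_1,\mathfrak K_2)=\inf_{\mathcal F}\beta_{\mathcal F}(\mathfrak K_1,\mathfrak K_2),$$ the last infimum being over all common S-correspondences $\mathcal F$ for $\mathfrak K_1,\mathfrak K_2$ (with $\inf\emptyset=\infty$). **Proposition.** There is an S-correspondence $\mathcal F$ from $\mathcal B$ to $\mathcal C$ that is a von Neumann $\mathcal C$-module and such that: (i) for all $\mathfrak K_1,\mathfrak K_2\in\mathcal K^\alpha_\Omega(\mathcal B,\mathcal C)$, $\mathcal F$ is a common S-correspondence for $\mathfrak K_1,\mathfrak K_2$ and $\beta(\mathfrak K_1,\mathfrak K_2)=\beta_{\mathcal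 F}(\mathfrak K_1,\mathfrak K_2)$; (ii) for each $\mathfrak K_1\in\mathcal K^\alpha_\Omega(\mathcal B,\mathcal C)$ there is $\mathfrak i_1\in\mathcal S(\mathcal F,\mathfrak K_1)$ such that for every $\mathfrak K_2\in\mathcal K^\alpha_\Omega(\mathcal B,\mathcal C)$ $$\beta(\mathfrak K_1,\mathfrak K_2)=\inf\{\|\mathfrak i_1(\sigma)-\mathfrak i_2(\sigma)\|:\mathfrak i_2\in\mathcal S(\mathcal F,\mathfrak K_2),\ \sigma\in\Omega\}.$$ -/

import Mathlib

open scoped ENNReal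

universe u v w t

namespace Bures

/-! ### The C*-algebra structure of a von Neumann algebra -/

section VonNeumann

variable {H : Type v} [NormedAddCommGroup H] [InnerProductSpace ℂ H] [CompleteSpace H]

/-- A von Neumann algebra is norm closed, hence a unital C*-algebra. -/
instance isClosed_vonNeumann (C : VonNeumannAlgebra H) :
    IsClosed (C.toStarSubalgebra : Set (H →L[ℂ] H)) := by
  have h : (C.toStarSubalgebra : Set (H →L[ℂ] H)) =
      Set.centralizer (Set.centralizer (C : Set (H →L[ℂ] H))) := by
    rw [VonNeumannAlgebra.centralizer_centralizer]; rfl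
  rw [h]
  exact Set.isClosed_centralizer _

/-- The order that a von Neumann algebra inherits from the operators on `H` is its order as a
C*-algebra: the positive elements are those of the form `star s * s`. -/
instance starOrderedRing_vonNeumann (C : VonNeumannAlgebra H) :
    StarOrderedRing C.toStarSubalgebra := by
  refine StarOrderedRing.of_nonneg_iff' (fun {x y} h z => ?_) (fun x => ⟨fun hx => ?_, ?_⟩)
  · have h' : (x : H →L[ℂ] H) ≤ y := h
    exact show (z : H →L[ℂ] H) + x ≤ z + y from by gcongr
  · have hx' : (0 : H →L[ℂ] H) ≤ x := hx
    have hs : IsSelfAdjoint (CFC.sqrt (x : H →L[ℂ] H)) :=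
      (CFC.sqrt_nonneg (x : H →L[ℂ] H)).isSelfAdjoint
    have hmem : CFC.sqrt (x : H →L[ℂ] H) ∈ C := by
      have hc : CFC.sqrt (x : H →L[ℂ] H) ∈
          Set.centralizer (Set.centralizer (C : Set (H →L[ℂ] H))) := by
        intro g hg
        have hgx : Commute (x : H →L[ℂ] H) g := hg x x.2
        exact (hgx.cfcₙ_nnreal _).symm.eq
      rwa [VonNeumannAlgebra.centralizer_centralizer] at hc
    refine ⟨⟨CFC.sqrt (x : H →L[ℂ] H), hmem⟩, Subtype.ext ?_⟩
    show (x : H →L[ℂ] H) = star (CFC.sqrt (x : H →L[ℂ] H)) * CFC.sqrt (x : H →L[ℂ] H)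
    rw [hs.star_eq, CFC.sqrt_mul_sqrt_self _ hx']
  · rintro ⟨s, rfl⟩
    exact show (0 : H →L[ℂ] H) ≤ star (s : H →L[ℂ] H) * s from star_mul_self_nonneg _

end VonNeumann

/-! ### Hilbert modules -/

/-- A Hilbert `A`-module: a complex Banach space `E` with a compatible right action of `A`
(written as a left action of `Aᵐᵒᵖ`) and an `A`-valued inner product, linear in the second
variable, that induces the norm of `E`. -/
class HilbertModule (A : Type v) [CStarAlgebra A] [PartialOrder A] [StarOrderedRing A]
    (E : Type w) [NormedAddCommGroup E] [NormedSpace ℂ E] [CompleteSpace E] [Module Aᵐᵒᵖ E] where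
  /-- The `A`-valued inner product. -/
  ip : E → E → A
  smul_op (z : ℂ) (x : E) (a : A) : MulOpposite.op (z • a) • x = z • (MulOpposite.op a • x)
  op_smul (z : ℂ) (x : E) (a : A) : MulOpposite.op a • (z • x) = z • (MulOpposite.op a • x)
  ip_self_nonneg (x : E) : 0 ≤ ip x x
  ip_self_eq_zero (x : E) : ip x x = 0 → x = 0
  ip_op_smul (x y : E) (a : A) : ip x (MulOpposite.op a • y) = ip x y * a
  star_ip (x y : E) : star (ip y x) = ip x y
  ip_add (x y z : E) : ip x (y + z) = ip x y + ip x z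
  ip_smul (x y : E) (z : ℂ) : ip x (z • y) = z • ip x y
  norm_eq (x : E) : ‖x‖ = √‖ip x x‖

section Adjointable

variable (A : Type v) [CStarAlgebra A] [PartialOrder A] [StarOrderedRing A]
  (E : Type w) [NormedAddCommGroup E] [NormedSpace ℂ E] [CompleteSpace E] [Module Aᵐᵒᵖ E]
  [HilbertModule A E]

open HilbertModule

variable {E} in
theorem ip_add_left (x y z : E) : ip (A := A) (x + y) z = ip x z + ip y z := by
  rw [← star_ip, ip_add, star_add, star_ip, star_ip]

variable {E} in
theorem ip_smul_left (c : ℂ) (x y : E) : ip (A := A) (c • x) y = star c • ip x y := by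
  rw [← star_ip, ip_smul, star_smul, star_ip]

/-- The algebra `Bᵃ(E)` of adjointable operators on a Hilbert `A`-module `E`. -/
def adjointable : Subalgebra ℂ (E →L[ℂ] E) where
  carrier := {T | ∃ S : E →L[ℂ] E, ∀ x y, ip (A := A) (T x) y = ip x (S y)}
  mul_mem' := by
    rintro T T' ⟨S, hS⟩ ⟨S', hS'⟩
    exact ⟨S' * S, fun x y => by simp [hS, hS']⟩
  add_mem' := by
    rintro T T' ⟨S, hS⟩ ⟨S', hS'⟩
    exact ⟨S + S', fun x y => by simp [ip_add_left, ip_add, hS, hS']⟩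
  algebraMap_mem' c :=
    ⟨star c • 1, fun x y => by
      simp [Algebra.algebraMap_eq_smul_one, ip_smul_left, ip_smul]⟩

end Adjointable

/-! ### Von Neumann modules -/

section VonNeumannModule

variable {H : Type v} [NormedAddCommGroup H] [InnerProductSpace ℂ H] [CompleteSpace H]

/-- `L : E → 𝓑(H, G)` exhibits the Hilbert space `G` as the interior tensor product `E ⊗ H`, with
`L x h = x ⊗ h`: one has `⟨x ⊗ h, y ⊗ k⟩ = ⟨h, ⟨x, y⟩ k⟩`, i.e. `(L x)* (L y) = ⟨x, y⟩`, and the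
elementary tensors are total in `G`. This determines `(G, L)` up to a unique unitary. -/
structure IsInteriorTensor (C : VonNeumannAlgebra H)
    (E : Type w) [NormedAddCommGroup E] [NormedSpace ℂ E] [CompleteSpace E]
    [Module (C.toStarSubalgebra)ᵐᵒᵖ E] [HilbertModule C.toStarSubalgebra E]
    {G : Type t} [NormedAddCommGroup G] [InnerProductSpace ℂ G] [CompleteSpace G]
    (L : E →ₗ[ℂ] H →L[ℂ] G) : Prop where
  adjoint_comp (x y : E) : (ContinuousLinearMap.adjoint (L x)).comp (L y) =
    (HilbertModule.ip (A := C.toStarSubalgebra) x y : H →L[ℂ] H)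
  total : (Submodule.span ℂ {g : G | ∃ x h, g = L x h}).topologicalClosure = ⊤

/-- A Hilbert `C`-module `E` over a von Neumann algebra `C` acting on `H` is a von Neumann
`C`-module if the set of the operators `h ↦ x ⊗ h`, `x ∈ E`, is closed in `𝓑(H, E ⊗ H)` in the
strong operator topology (the topology of pointwise convergence `H →Lₚₜ[ℂ] E ⊗ H`). -/
def IsVonNeumannModule (C : VonNeumannAlgebra H)
    (E : Type w) [NormedAddCommGroup E] [NormedSpace ℂ E] [CompleteSpace E]
    [Module (C.toStarSubalgebra)ᵐᵒᵖ E] [HilbertModule C.toStarSubalgebra E] : Prop :=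
  ∃ (G : Type (max v w)) (_ : NormedAddCommGroup G) (_ : InnerProductSpace ℂ G)
    (_ : CompleteSpace G) (L : E →ₗ[ℂ] H →L[ℂ] G),
    IsInteriorTensor C E L ∧
    IsClosed {T : H →Lₚₜ[ℂ] G | ∃ x : E, ∀ h : H, T h = L x h}

end VonNeumannModule

/-! ### Kernels, S-correspondences and the Bures distance -/

variable {Ω : Type w} {B : Type u} [CStarAlgebra B]
  {A : Type v} [CStarAlgebra A] [PartialOrder A] [StarOrderedRing A]

/-- `α`-completely positive definite kernels over `Ω` from `B` to `A`. -/
structure IsCPDKernel (α : B ≃⋆ₐ[ℂ] B) (K : Ω → Ω → B →L[ℂ] A) : Prop where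
  hermitian (σ σ' : Ω) (b : B) : K σ σ' (star b) = star (K σ' σ b)
  nonneg (n : ℕ) (σ : Fin n → Ω) (b : Fin n → B) (c : Fin n → A) :
    0 ≤ ∑ i, ∑ j, star (c i) * K (σ i) (σ j) (star (α (b i)) * b j) * c j
  map_aut (σ σ' : Ω) (b : B) : K σ σ' (α b) = K σ σ' b
  bounded (b : B) : ∃ M : ℝ, 0 < M ∧
    ∀ (n : ℕ) (σ : Fin n → Ω) (b' : Fin n → B) (c : Fin n → A),
      ‖∑ i, ∑ j, star (c i) * K (σ i) (σ j) (α (star (b' i) * star b) * b * b' j) * c j‖ ≤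
        M * ‖∑ i, ∑ j, star (c i) * K (σ i) (σ j) (α (star (b' i)) * b' j) * c j‖

variable (B A) in
/-- An S-correspondence from `B` to `A`: a Hilbert `A`-module with a unitary `U` and a
`U`-representation `π` of `B`, i.e. a homomorphism of unital algebras `π : B → Bᵃ(E)` with
`[π(b) x, y] = [x, π(b*) y]` for the form `[x, y] = ⟨x, U y⟩`. -/
structure SCorrespondence where
  /-- The underlying space. -/
  E : Type t
  [normedAddCommGroup : NormedAddCommGroup E]
  [normedSpace : NormedSpace ℂ E]
  [completeSpace : CompleteSpace E]
  [module : Module Aᵐᵒᵖ E]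
  [hilbertModule : HilbertModule A E]
  /-- The unitary. -/
  U : E ≃ₗ[ℂ] E
  ip_U (x y : E) : HilbertModule.ip (A := A) (U x) y = HilbertModule.ip x (U.symm y)
  /-- The left action of `B`. -/
  π : B →ₐ[ℂ] adjointable A E
  ip_π (b : B) (x y : E) :
    HilbertModule.ip (A := A) ((π b : E →L[ℂ] E) x) (U y) =
      HilbertModule.ip x (U ((π (star b) : E →L[ℂ] E) y))

namespace SCorrespondence

attribute [instance] normedAddCommGroup normedSpace completeSpace module hilbertModule

variable (F : SCorrespondence.{u, v, t} B A)

/-- The set `S(F, K)` of the maps `i : Ω → F` that realize the kernel `K` in `F`,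
`K^{σ,σ'}(b) = ⟨i(σ), b i(σ')⟩ = ⟨α(b*) i(σ), i(σ')⟩`, in such a way that `U` implements `α` on the
vectors `b i(σ)` (hence also `U (b i(σ) c) = α(b) i(σ) c`, because `U` commutes with the right
action). -/
def realizations (α : B ≃⋆ₐ[ℂ] B) (K : Ω → Ω → B →L[ℂ] A) : Set (Ω → F.E) :=
  {i | (∀ σ σ' b, K σ σ' b = HilbertModule.ip (i σ) ((F.π b : F.E →L[ℂ] F.E) (i σ'))) ∧
    (∀ σ σ' b, K σ σ' b =
      HilbertModule.ip ((F.π (α (star b)) : F.E →L[ℂ] F.E) (i σ)) (i σ')) ∧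
    ∀ σ b, F.U ((F.π b : F.E →L[ℂ] F.E) (i σ)) = (F.π (α b) : F.E →L[ℂ] F.E) (i σ)}

/-- `F` is a common S-correspondence for the kernels `K₁` and `K₂`. -/
def IsCommon (α : B ≃⋆ₐ[ℂ] B) (K₁ K₂ : Ω → Ω → B →L[ℂ] A) : Prop :=
  (F.realizations α K₁).Nonempty ∧ (F.realizations α K₂).Nonempty

/-- `β_F(K₁, K₂)`, the infimum of `‖i₁(σ) - i₂(σ)‖` over all `i₁ ∈ S(F, K₁)`, `i₂ ∈ S(F, K₂)` and
`σ ∈ Ω`. It is taken in `[0, ∞]`. -/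
noncomputable def bures (α : B ≃⋆ₐ[ℂ] B) (K₁ K₂ : Ω → Ω → B →L[ℂ] A) : ℝ≥0∞ :=
  ⨅ (i₁ ∈ F.realizations α K₁) (i₂ ∈ F.realizations α K₂) (σ : Ω), ‖i₁ σ - i₂ σ‖ₑ

end SCorrespondence

/-- The Bures distance: the infimum of `β_F(K₁, K₂)` over all common S-correspondences `F`. -/
noncomputable def buresDist (α : B ≃⋆ₐ[ℂ] B) (K₁ K₂ : Ω → Ω → B →L[ℂ] A) : ℝ≥0∞ :=
  ⨅ (F : SCorrespondence.{u, v, max u v w} B A) (_ : F.IsCommon α K₁ K₂), F.bures α K₁ K₂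

end Bures

/-! The distances of two realizations `j₁`, `j₂` in the same S-correspondence depend only on the
inner products of their values. Together `j₁` and `j₂` form one covariant map on `Ω ⊕ Ω`, whose
kernel `⟨j(s), b j(s')⟩` records these inner products, including the mixed ones. Kernels on `Ω ⊕ Ω`,
unlike S-correspondences, form a set, so all positive ones can be placed in a single block diagonal
kernel (`IsPositiveKernel.blockKernel`). A correspondence realizing it realizes every such pair up
to isometry.

To make `i₁` independent of `K₂`, each block occurs twice and `K₁` has its own block in the first
copy. A pair `(j₁, j₂)` lives in a block of the second copy, orthogonal to the first. The vectors of
`K₁` in the two blocks have the same Gram kernel, so a self-adjoint unitary commuting with all the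
structure interchanges them (`Dilation.exists_swap`). It carries the copy of `j₁` to `i₁` and that
of `j₂` to the required `i₂`. This is `exists_universal`, and the proposition follows by comparing
infima.

A positive kernel is realized on the reproducing kernel Hilbert space `G` of the operators `J s s'
(α(b)* b')`. The commutant of `C`, the automorphism `α` and left multiplication by `B` act on the
total vectors `V b s h`. `exists_operator` makes these actions bounded operators from formal
adjoints and growth of iterates alone. The operators `H → G` intertwining the commutant actions are
the desired module: it is `C`-valued by the double commutant theorem and strongly closed because
intertwining is a pointwise condition. -/

namespace Bures

open ContinuousLinearMap

/-! ### The von Neumann module of intertwiners -/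

section Intertwiners

variable {H : Type v} [NormedAddCommGroup H] [InnerProductSpace ℂ H] [CompleteSpace H]

/-- A `*`-preserving family of operators on `G` indexed by the commutant of `C`. -/
structure CommutantRep (C : VonNeumannAlgebra H) (G : Type t) [NormedAddCommGroup G]
    [InnerProductSpace ℂ G] [CompleteSpace G] where
  /-- The operator attached to an element of the commutant. -/
  op : C.commutant → G →L[ℂ] G
  adjoint_op (d : C.commutant) : adjoint (op d) = op (star d)

variable {C : VonNeumannAlgebra H} {G : Type t} [NormedAddCommGroup G]
  [InnerProductSpace ℂ G] [CompleteSpace G]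

namespace CommutantRep

variable (ρ : CommutantRep C G)

/-- The operators from `H` to `G` that intertwine the commutant of `C` and its representation. -/
def intertwiners : Submodule ℂ (H →L[ℂ] G) where
  carrier := {x | ∀ (d : C.commutant) (h : H), x ((d : H →L[ℂ] H) h) = ρ.op d (x h)}
  add_mem' hx hy d h := by simp [hx d h, hy d h]
  zero_mem' d h := by simp
  smul_mem' z x hx d h := by simp [hx d h]

theorem mem_intertwiners {x : H →L[ℂ] G} : x ∈ ρ.intertwiners ↔
    ∀ (d : C.commutant) (h : H), x ((d : H →L[ℂ] H) h) = ρ.op d (x h) := Iff.rfl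

theorem isClosed_intertwiners : IsClosed (ρ.intertwiners : Set (H →L[ℂ] G)) := by
  have h : (ρ.intertwiners : Set (H →L[ℂ] G)) = ⋂ (d : C.commutant) (h : H),
      {x | x ((d : H →L[ℂ] H) h) = ρ.op d (x h)} := by
    ext x
    simp [mem_intertwiners]
  rw [h]
  refine isClosed_iInter fun d => isClosed_iInter fun h => isClosed_eq ?_ ?_ <;> fun_prop

theorem commute_of_mem {c d : H →L[ℂ] H} (hc : c ∈ C) (hd : d ∈ C.commutant) (h : H) :
    c (d h) = d (c h) :=
  congrArg (fun T : H →L[ℂ] H => T h) (VonNeumannAlgebra.mem_commutant_iff.1 hd c hc)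

theorem comp_mem_intertwiners {x : H →L[ℂ] G} (hx : x ∈ ρ.intertwiners) {c : H →L[ℂ] H}
    (hc : c ∈ C) : x.comp c ∈ ρ.intertwiners := fun d h => by
  simp [commute_of_mem hc d.2, hx d]

/-- Moving `d` through `y` gives `ρ.op d`, and moving this through `x*` gives `d` back because `ρ`
preserves adjoints. So `x* y` commutes with the commutant and lies in `C` by the double commutant
theorem. Multiplicativity of `ρ` plays no role. -/
theorem adjoint_comp_mem {x y : H →L[ℂ] G} (hx : x ∈ ρ.intertwiners) (hy : y ∈ ρ.intertwiners) :
    (adjoint x).comp y ∈ C := by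
  rw [← VonNeumannAlgebra.commutant_commutant C, VonNeumannAlgebra.mem_commutant_iff]
  intro d hd
  have hx' : ∀ g, adjoint x (ρ.op ⟨d, hd⟩ g) = d (adjoint x g) := fun g => by
    refine ext_inner_left ℂ fun k => ?_
    have h1 : ρ.op ⟨d, hd⟩ = adjoint (ρ.op (star ⟨d, hd⟩)) := by
      rw [ρ.adjoint_op, star_star]
    have h2 := hx (star ⟨d, hd⟩) k
    rw [adjoint_inner_right, h1, adjoint_inner_right, ← h2, ← adjoint_inner_right,
      ← adjoint_inner_right]
    simp [star_eq_adjoint]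
  ext h
  have hy' := hy ⟨d, hd⟩ h
  simp only at hy'
  simp [hy', hx']

/-- The Hilbert module of the intertwiners. -/
def Intertwiner (ρ : CommutantRep C G) : Type (max v t) := ρ.intertwiners

noncomputable instance : NormedAddCommGroup ρ.Intertwiner :=
  inferInstanceAs (NormedAddCommGroup ρ.intertwiners)

noncomputable instance : NormedSpace ℂ ρ.Intertwiner :=
  inferInstanceAs (NormedSpace ℂ ρ.intertwiners)

instance : CompleteSpace ρ.Intertwiner :=
  ρ.isClosed_intertwiners.completeSpace_coe

/-- An intertwiner as an operator. -/
noncomputable def toCLM : ρ.Intertwiner →ₗ[ℂ] H →L[ℂ] G := ρ.intertwiners.subtype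

theorem toCLM_mem (x : ρ.Intertwiner) : ρ.toCLM x ∈ ρ.intertwiners := x.2

theorem norm_toCLM (x : ρ.Intertwiner) : ‖ρ.toCLM x‖ = ‖x‖ := rfl

/-- An operator that intertwines the representations as an element of the module. -/
def ofMem (x : H →L[ℂ] G) (hx : x ∈ ρ.intertwiners) : ρ.Intertwiner := ⟨x, hx⟩

theorem toCLM_injective : Function.Injective ρ.toCLM := Subtype.val_injective

theorem intertwiner_ext {x y : ρ.Intertwiner} (h : ∀ k, ρ.toCLM x k = ρ.toCLM y k) : x = y :=
  ρ.toCLM_injective (ContinuousLinearMap.ext h)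

noncomputable instance : Module (C.toStarSubalgebra)ᵐᵒᵖ ρ.Intertwiner where
  smul c x := ρ.ofMem ((ρ.toCLM x).comp (c.unop : H →L[ℂ] H))
    (ρ.comp_mem_intertwiners (ρ.toCLM_mem x) c.unop.2)
  one_smul _ := rfl
  mul_smul _ _ _ := rfl
  smul_zero _ := rfl
  smul_add _ _ _ := rfl
  add_smul _ _ x := ρ.intertwiner_ext fun _ => map_add (ρ.toCLM x) _ _
  zero_smul x := ρ.intertwiner_ext fun _ => map_zero (ρ.toCLM x)

/-- The `C`-valued inner product `x* y` of intertwiners. -/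
noncomputable def innerProd (x y : ρ.Intertwiner) : C.toStarSubalgebra :=
  ⟨(adjoint (ρ.toCLM x)).comp (ρ.toCLM y), ρ.adjoint_comp_mem (ρ.toCLM_mem x) (ρ.toCLM_mem y)⟩

theorem coe_innerProd (x y : ρ.Intertwiner) : (ρ.innerProd x y : H →L[ℂ] H) =
    (adjoint (ρ.toCLM x)).comp (ρ.toCLM y) := rfl

theorem innerProd_self_nonneg (x : ρ.Intertwiner) : 0 ≤ ρ.innerProd x x := by
  have h : (0 : H →L[ℂ] H) ≤ (ρ.innerProd x x : H →L[ℂ] H) := by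
    rw [coe_innerProd, ContinuousLinearMap.nonneg_iff_isPositive]
    exact isPositive_adjoint_comp_self _
  exact h

theorem norm_eq_sqrt_innerProd (x : ρ.Intertwiner) : ‖x‖ = √‖ρ.innerProd x x‖ := by
  have h : ‖ρ.innerProd x x‖ = ‖(ρ.innerProd x x : H →L[ℂ] H)‖ := rfl
  rw [h, coe_innerProd, norm_adjoint_comp_self, Real.sqrt_mul_self (norm_nonneg _), norm_toCLM]

noncomputable instance : HilbertModule C.toStarSubalgebra ρ.Intertwiner where
  ip := ρ.innerProd
  smul_op z x a := ρ.intertwiner_ext fun h => map_smul (ρ.toCLM x) z ((a : H →L[ℂ] H) h)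
  op_smul z x a := rfl
  ip_self_nonneg := ρ.innerProd_self_nonneg
  ip_self_eq_zero x hx := norm_eq_zero.1 <|
    (ρ.norm_eq_sqrt_innerProd x).trans (by rw [hx, norm_zero, Real.sqrt_zero])
  ip_op_smul x y a := rfl
  star_ip x y := Subtype.ext <| by
    have h : ((star (ρ.innerProd y x) : C.toStarSubalgebra) : H →L[ℂ] H) =
      adjoint (ρ.innerProd y x : H →L[ℂ] H) := rfl
    rw [h, coe_innerProd, coe_innerProd, adjoint_comp, adjoint_adjoint]
  ip_add x y z := Subtype.ext (comp_add (adjoint (ρ.toCLM x)) (ρ.toCLM y) (ρ.toCLM z))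
  ip_smul x y z := Subtype.ext (comp_smul (adjoint (ρ.toCLM x)) z (ρ.toCLM y))
  norm_eq := ρ.norm_eq_sqrt_innerProd

theorem coe_ip (x y : ρ.Intertwiner) :
    ((HilbertModule.ip x y : C.toStarSubalgebra) : H →L[ℂ] H) =
      (adjoint (ρ.toCLM x)).comp (ρ.toCLM y) := rfl

/-- Intertwiners form a von Neumann module if their ranges span a dense subspace. -/
theorem isVonNeumannModule {G : Type (max v t)} [NormedAddCommGroup G]
    [InnerProductSpace ℂ G] [CompleteSpace G] (ρ : CommutantRep C G)
    (hρ : (Submodule.span ℂ {g : G | ∃ (x : ρ.Intertwiner) (h : H), g = ρ.toCLM x h}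
      ).topologicalClosure = ⊤) :
    IsVonNeumannModule C ρ.Intertwiner := by
  refine ⟨G, inferInstance, inferInstance, inferInstance, ρ.toCLM, ⟨fun x y => rfl, hρ⟩, ?_⟩
  -- The intertwining relation compares values of `T` at single vectors, so it survives pointwise
  -- limits.
  have h : {T : H →Lₚₜ[ℂ] G | ∃ x : ρ.Intertwiner, ∀ h : H, T h = ρ.toCLM x h} =
      ⋂ (d : C.commutant) (h : H), {T | T ((d : H →L[ℂ] H) h) = ρ.op d (T h)} := by
    ext T
    simp only [Set.mem_ofPred_eq, Set.mem_iInter]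
    constructor
    · rintro ⟨x, hx⟩ d h
      rw [hx, hx]
      exact ρ.toCLM_mem x d h
    · intro hT
      exact ⟨ρ.ofMem ⟨T.toLinearMap, T.cont⟩ hT, fun h => rfl⟩
  rw [h]
  have hev : ∀ k : H, Continuous fun T : H →Lₚₜ[ℂ] G => T k := fun k =>
    (PointwiseConvergenceCLM.evalCLM (RingHom.id ℂ) G k).continuous
  exact isClosed_iInter fun d => isClosed_iInter fun h =>
    isClosed_eq (hev _) ((ρ.op d).continuous.comp (hev _))

/-- Composition with an operator that commutes with the representation of the commutant. -/
noncomputable def lift (T : G →L[ℂ] G) (hT : ∀ d g, T (ρ.op d g) = ρ.op d (T g)) :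
    ρ.Intertwiner →L[ℂ] ρ.Intertwiner :=
  LinearMap.mkContinuous
    { toFun := fun x => ρ.ofMem (T.comp (ρ.toCLM x)) fun d h => by
        simp [ρ.toCLM_mem x d h, hT]
      map_add' := fun x y => ρ.intertwiner_ext fun h => map_add T (ρ.toCLM x h) (ρ.toCLM y h)
      map_smul' := fun z x => ρ.intertwiner_ext fun h => map_smul T z (ρ.toCLM x h) } ‖T‖ fun x => by
    rw [← norm_toCLM, ← norm_toCLM]
    exact opNorm_comp_le _ _

theorem toCLM_lift (T : G →L[ℂ] G) (hT) (x : ρ.Intertwiner) :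
    ρ.toCLM (ρ.lift T hT x) = T.comp (ρ.toCLM x) := rfl

theorem adjoint_commute {T : G →L[ℂ] G} (hT : ∀ d g, T (ρ.op d g) = ρ.op d (T g))
    (d : C.commutant) (g : G) : adjoint T (ρ.op d g) = ρ.op d (adjoint T g) := by
  refine ext_inner_left ℂ fun k => ?_
  have h1 : ρ.op d = adjoint (ρ.op (star d)) := by rw [ρ.adjoint_op, star_star]
  rw [adjoint_inner_right, h1, adjoint_inner_right, adjoint_inner_right, adjoint_inner_right, hT]

theorem ip_lift (T : G →L[ℂ] G) (hT) (x y : ρ.Intertwiner) :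
    HilbertModule.ip (A := C.toStarSubalgebra) (ρ.lift T hT x) y =
      HilbertModule.ip x (ρ.lift (adjoint T) (ρ.adjoint_commute hT) y) := by
  refine Subtype.ext ?_
  rw [coe_ip, coe_ip, toCLM_lift, toCLM_lift, adjoint_comp]
  rfl

variable {B : Type u} [CStarAlgebra B]

/-- The S-correspondence of intertwiners attached to a unitary and a representation on `G`. -/
noncomputable def correspondence (U : G →L[ℂ] G) (hU : ∀ d g, U (ρ.op d g) = ρ.op d (U g))
    (hU₁ : ∀ g, adjoint U (U g) = g) (hU₂ : ∀ g, U (adjoint U g) = g)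
    (π : B →ₐ[ℂ] G →L[ℂ] G) (hπ : ∀ b d g, π b (ρ.op d g) = ρ.op d (π b g))
    (hUπ : ∀ b g, adjoint (π b) (U g) = U (π (star b) g)) :
    SCorrespondence.{u, v, max v t} B C.toStarSubalgebra where
  E := ρ.Intertwiner
  U :=
    { toLinearMap := ρ.lift U hU
      invFun := ρ.lift (adjoint U) (ρ.adjoint_commute hU)
      left_inv := fun x => ρ.intertwiner_ext fun h => hU₁ _
      right_inv := fun x => ρ.intertwiner_ext fun h => hU₂ _ }
  ip_U x y := ρ.ip_lift U hU x y
  π :=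
    { toFun := fun b => ⟨ρ.lift (π b) (hπ b), _, ρ.ip_lift (π b) (hπ b)⟩
      map_one' := Subtype.ext <| ContinuousLinearMap.ext fun x => ρ.intertwiner_ext fun h =>
        congrArg (fun T : G →L[ℂ] G => T (ρ.toCLM x h)) (map_one π)
      map_mul' := fun a b => Subtype.ext <| ContinuousLinearMap.ext fun x =>
        ρ.intertwiner_ext fun h => congrArg (fun T : G →L[ℂ] G => T (ρ.toCLM x h)) (map_mul π a b)
      map_zero' := Subtype.ext <| ContinuousLinearMap.ext fun x => ρ.intertwiner_ext fun h =>
        congrArg (fun T : G →L[ℂ] G => T (ρ.toCLM x h)) (map_zero π)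
      map_add' := fun a b => Subtype.ext <| ContinuousLinearMap.ext fun x =>
        ρ.intertwiner_ext fun h => congrArg (fun T : G →L[ℂ] G => T (ρ.toCLM x h)) (map_add π a b)
      commutes' := fun z => Subtype.ext <| ContinuousLinearMap.ext fun x =>
        ρ.intertwiner_ext fun h =>
          congrArg (fun T : G →L[ℂ] G => T (ρ.toCLM x h)) (AlgHom.commutes π z) }
  ip_π b x y := by
    refine (ρ.ip_lift (π b) (hπ b) x _).trans (congrArg _ ?_)
    exact ρ.intertwiner_ext fun h => hUπ b _

end CommutantRep

end Intertwiners

/-! ### Operators defined on a total family of vectors -/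

section Operators

/-- A log-convex sequence of exponential growth with rate `M` grows by at most `M` in its first
step. -/
theorem logConvex_le_mul {a : ℕ → ℝ} (ha : ∀ n, 0 ≤ a n)
    (hconv : ∀ n, a (n + 1) ^ 2 ≤ a n * a (n + 2)) {M K : ℝ} (hM : 0 < M)
    (hK : ∀ n, a n ≤ K * M ^ n) : a 1 ≤ M * a 0 := by
  by_contra! hlt
  have h0 : 0 < a 0 := by
    rcases (ha 0).eq_or_lt with h | h
    · have h1 := hconv 0
      rw [← h, zero_mul] at h1
      have h2 : a 1 = 0 := pow_eq_zero_iff two_ne_zero |>.1 (le_antisymm h1 (sq_nonneg _))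
      rw [← h, h2] at hlt
      simp at hlt
    · exact h
  -- Log-convexity prevents the successive ratios from decreasing, so `a n ≥ a 0 * r ^ n`. Since `r
  -- > M`, this contradicts the bound `K * M ^ n`.
  set r := a 1 / a 0 with hr
  have hMr : M < r := (lt_div_iff₀ h0).2 hlt
  have hr0 : 0 < r := hM.trans hMr
  have hstep : ∀ n, a n * r ≤ a (n + 1) := by
    intro n
    induction n with
    | zero => rw [hr, mul_div_cancel₀ _ h0.ne']
    | succ n ih =>
      rcases (ha (n + 1)).eq_or_lt with h | h
      · rw [← h, zero_mul]
        exact ha _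
      · refine le_of_mul_le_mul_left ?_ h
        calc a (n + 1) * (a (n + 1) * r) = a (n + 1) ^ 2 * r := by ring
          _ ≤ a n * a (n + 2) * r := mul_le_mul_of_nonneg_right (hconv n) hr0.le
          _ = a n * r * a (n + 2) := by ring
          _ ≤ a (n + 1) * a (n + 2) := mul_le_mul_of_nonneg_right ih (ha _)
  have hpow : ∀ n, a 0 * r ^ n ≤ a n := by
    intro n
    induction n with
    | zero => simp
    | succ n ih =>
      calc a 0 * r ^ (n + 1) = a 0 * r ^ n * r := by ring
        _ ≤ a n * r := mul_le_mul_of_nonneg_right ih hr0.le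
        _ ≤ _ := hstep n
  have hlim : Filter.Tendsto (fun n => K * (M / r) ^ n) Filter.atTop (nhds (K * 0)) :=
    (tendsto_pow_atTop_nhds_zero_of_lt_one (by positivity) ((div_lt_one hr0).2 hMr)).const_mul K
  rw [mul_zero] at hlim
  refine h0.not_ge (ge_of_tendsto' hlim fun n => ?_)
  rw [div_pow, ← mul_div_assoc, le_div_iff₀ (by positivity)]
  exact (hpow n).trans (hK n)

variable {G : Type t} [NormedAddCommGroup G] [InnerProductSpace ℂ G] {I : Type w}

theorem eq_of_forall_inner {v : I → G}
    (hv : (Submodule.span ℂ (Set.range v)).topologicalClosure = ⊤) {x y : G}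
    (h : ∀ i, inner ℂ (v i) x = inner ℂ (v i) y) : x = y := by
  have h' : innerSL ℂ x = innerSL ℂ y :=
    ContinuousLinearMap.ext_on (Submodule.dense_iff_topologicalClosure_eq_top.2 hv) (by
      rintro _ ⟨i, rfl⟩
      rw [innerSL_apply_apply, innerSL_apply_apply, ← inner_conj_symm, h i, inner_conj_symm])
  exact ext_inner_right ℂ fun z => congrArg (fun f : G →L[ℂ] ℂ => f z) h'

theorem clm_ext {F : Type*} [NormedAddCommGroup F] [NormedSpace ℂ F] {v : I → G}
    (hv : (Submodule.span ℂ (Set.range v)).topologicalClosure = ⊤) {S T : G →L[ℂ] F}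
    (h : ∀ i, S (v i) = T (v i)) : S = T :=
  ContinuousLinearMap.ext_on (Submodule.dense_iff_topologicalClosure_eq_top.2 hv)
    (by rintro _ ⟨i, rfl⟩; exact h i)

open Finsupp in
/-- Maps `f`, `g` of the index set of a total family that are formally adjoint to each other and
of exponential growth define a bounded operator and its adjoint. -/
theorem exists_operator [CompleteSpace G] {v : I → G}
    (hv : (Submodule.span ℂ (Set.range v)).topologicalClosure = ⊤) {f g : I → I}
    (hfg : ∀ i j, inner ℂ (v (f i)) (v j) = inner ℂ (v i) (v (g j))) {M : ℝ} (hM : 0 < M)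
    (hbd : ∀ i, ∃ K, ∀ n, ‖v ((g ∘ f)^[n] i)‖ ≤ K * M ^ n) :
    ∃ T : G →L[ℂ] G, (∀ i, T (v i) = v (f i)) ∧
      ∀ i, ContinuousLinearMap.adjoint T (v i) = v (g i) := by
  let Φ : (I →₀ ℂ) →ₗ[ℂ] G := linearCombination ℂ v
  let D (f : I → I) : (I →₀ ℂ) →ₗ[ℂ] (I →₀ ℂ) := lmapDomain ℂ ℂ f
  have hΦ : ∀ i c, Φ (single i c) = c • v i := fun i c => linearCombination_single ..
  have hD : ∀ f i c, D f (single i c) = single (f i) c := fun f i c => mapDomain_single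
  have hdense : DenseRange Φ := by
    have h : (Φ.range : Set G) = Set.range Φ := LinearMap.coe_range _
    rw [DenseRange, ← h, range_linearCombination]
    exact Submodule.dense_iff_topologicalClosure_eq_top.2 hv
  have hadj : ∀ x y, inner ℂ (Φ (D f x)) (Φ y) = inner ℂ (Φ x) (Φ (D g y)) := by
    intro x y
    induction x using Finsupp.induction_linear with
    | zero => simp
    | add x x' hx hx' => simp only [map_add, inner_add_left, hx, hx']
    | single i c =>
      induction y using Finsupp.induction_linear with
      | zero => simp
      | add y y' hy hy' => simp only [map_add, inner_add_right, hy, hy']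
      | single j d => simp only [hD, hΦ, inner_smul_left, inner_smul_right, hfg]
  have hadj' : ∀ x y, inner ℂ (Φ (D g x)) (Φ y) = inner ℂ (Φ x) (Φ (D f y)) := fun x y => by
    rw [← inner_conj_symm, ← hadj, inner_conj_symm]
  -- `P` is the formal `T* T`. It is symmetric, so Cauchy–Schwarz makes `‖Φ (P ^ n x)‖` log-convex
  -- in `n`.
  let P : (I →₀ ℂ) →ₗ[ℂ] (I →₀ ℂ) := D g ∘ₗ D f
  have hP : ∀ x y, inner ℂ (Φ (P x)) (Φ y) = inner ℂ (Φ x) (Φ (P y)) := fun x y => by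
    simp only [P, LinearMap.comp_apply, hadj, hadj']
  have hPn : ∀ n i c, (P ^ n) (single i c) = single ((g ∘ f)^[n] i) c := by
    intro n i c
    induction n with
    | zero => simp
    | succ n ih =>
      rw [pow_succ', Module.End.mul_apply, ih, Function.iterate_succ_apply']
      simp only [P, LinearMap.comp_apply, hD, Function.comp_apply]
  -- `K` depends on `x` but the rate `M` does not; only the rate survives in the resulting operator
  -- bound.
  have hgrow : ∀ x, ∃ K, ∀ n, ‖Φ ((P ^ n) x)‖ ≤ K * M ^ n := by
    intro x
    induction x using Finsupp.induction_linear with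
    | zero => exact ⟨0, fun n => by simp⟩
    | add x x' hx hx' =>
      obtain ⟨K, hK⟩ := hx
      obtain ⟨K', hK'⟩ := hx'
      refine ⟨K + K', fun n => ?_⟩
      rw [map_add, map_add, add_mul]
      exact (norm_add_le _ _).trans (add_le_add (hK n) (hK' n))
    | single i c =>
      obtain ⟨K, hK⟩ := hbd i
      refine ⟨‖c‖ * K, fun n => ?_⟩
      rw [hPn, hΦ, norm_smul, mul_assoc]
      exact mul_le_mul_of_nonneg_left (hK n) (norm_nonneg _)
  have hnorm : ∀ x, ‖Φ (D f x)‖ ≤ √M * ‖Φ x‖ := by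
    intro x
    obtain ⟨K, hK⟩ := hgrow x
    have h1 : ‖Φ (P x)‖ ≤ M * ‖Φ x‖ := by
      have := logConvex_le_mul (a := fun n => ‖Φ ((P ^ n) x)‖) (fun n => norm_nonneg _)
        (fun n => ?_) hM hK
      · simpa using this
      · have h2 : inner ℂ (Φ ((P ^ (n + 1)) x)) (Φ ((P ^ (n + 1)) x)) =
            inner ℂ (Φ ((P ^ n) x)) (Φ ((P ^ (n + 2)) x)) := by
          rw [pow_succ' P (n + 1), Module.End.mul_apply, ← hP,
            ← Module.End.mul_apply, ← pow_succ' P n]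
        have h3 := norm_inner_le_norm (𝕜 := ℂ) (Φ ((P ^ n) x)) (Φ ((P ^ (n + 2)) x))
        rw [← h2, inner_self_eq_norm_sq_to_K] at h3
        simpa using h3
    have h4 : ‖Φ (D f x)‖ ^ 2 ≤ M * ‖Φ x‖ ^ 2 := by
      have h5 : inner ℂ (Φ (D f x)) (Φ (D f x)) = inner ℂ (Φ x) (Φ (P x)) := by
        rw [hadj]
        rfl
      have h6 := norm_inner_le_norm (𝕜 := ℂ) (Φ x) (Φ (P x))
      rw [← h5, inner_self_eq_norm_sq_to_K] at h6
      have h7 : ‖Φ (D f x)‖ ^ 2 ≤ ‖Φ x‖ * ‖Φ (P x)‖ := by simpa using h6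
      nlinarith [norm_nonneg (Φ x)]
    rw [← Real.sqrt_sq (norm_nonneg (Φ x)), ← Real.sqrt_mul hM.le]
    exact Real.le_sqrt_of_sq_le h4
  -- The estimate `hnorm` also gives well-definedness: a combination with `Φ x = 0` has `Φ (D f x) =
  -- 0`.
  let T : G →L[ℂ] G := (Φ ∘ₗ D f).extendOfNorm Φ
  have hT : ∀ i, T (v i) = v (f i) := fun i => by
    have h := LinearMap.extendOfNorm_eq (f := Φ ∘ₗ D f) hdense ⟨√M, hnorm⟩ (single i 1)
    simpa only [LinearMap.comp_apply, hD, hΦ, one_smul] using h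
  refine ⟨T, hT, fun i => eq_of_forall_inner hv fun j => ?_⟩
  rw [ContinuousLinearMap.adjoint_inner_right, hT, hfg]

end Operators

/-! ### Positive matrices over a C*-algebra -/

section Matrices

variable {A : Type v} [CStarAlgebra A]

/-- An `A`-valued sesquilinear form with self-adjoint diagonal is Hermitian. -/
theorem star_form_of_isSelfAdjoint {M : Type*} [AddCommGroup M] [Module ℂ M] (F : M → M → A)
    (hadd : ∀ x y z, F x (y + z) = F x y + F x z) (hadd' : ∀ x y z, F (x + y) z = F x z + F y z)
    (hsmul : ∀ (c : ℂ) x y, F x (c • y) = c • F x y)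
    (hsmul' : ∀ (c : ℂ) x y, F (c • x) y = star c • F x y)
    (hF : ∀ x, IsSelfAdjoint (F x x)) (x y : M) : star (F x y) = F y x := by
  -- Polarization: `x + y` and `x + i y` control the sum and the difference of `F x y` and `F y x`.
  have h1 := (hF (x + y)).star_eq
  have h2 := (hF (x + Complex.I • y)).star_eq
  simp only [hadd, hadd', hsmul, hsmul', star_add, star_smul, (hF x).star_eq, (hF y).star_eq,
    Complex.star_def, Complex.conj_I, smul_smul, map_neg, map_mul, neg_neg] at h1 h2
  have h3 : star (F x y) + star (F y x) = F x y + F y x := by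
    linear_combination (norm := module) h1
  have h4 : -star (F x y) + star (F y x) = F x y - F y x := by
    refine smul_right_injective A Complex.I_ne_zero ?_
    show Complex.I • (-star (F x y) + star (F y x)) = Complex.I • (F x y - F y x)
    linear_combination (norm := module) h2
  have h5 : (2 : ℂ) • star (F x y) = (2 : ℂ) • F y x := by
    linear_combination (norm := module) h3 - h4
  exact smul_right_injective A (two_ne_zero' ℂ) h5

/-- The negative part `p` of a self-adjoint element `m` of a C*-algebra. -/
theorem exists_negPart {m : A} (hm : IsSelfAdjoint m) : ∃ p q : A, star p = p ∧
    p * m = -(p * p) ∧ p * p * p = star q * q ∧ (p = 0 → ∃ s, m = star s * s) := by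
  -- The order is auxiliary. The conclusion is purely algebraic and so applies to matrices without
  -- choosing an order on them.
  let _ := CStarAlgebra.spectralOrder A
  have _ := CStarAlgebra.spectralOrderedRing A
  have hp : 0 ≤ m⁻ := CFC.negPart_nonneg m
  have hpsa : star m⁻ = m⁻ := hp.isSelfAdjoint.star_eq
  have hp3 : 0 ≤ m⁻ * m⁻ * m⁻ := by
    have := star_left_conjugate_nonneg hp m⁻
    rwa [hpsa] at this
  obtain ⟨q, hq⟩ := CStarAlgebra.nonneg_iff_eq_star_mul_self.1 hp3
  refine ⟨m⁻, q, hpsa, ?_, hq, fun h => ?_⟩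
  · have h := congrArg (m⁻ * ·) (CFC.posPart_sub_negPart m hm)
    simpa only [mul_sub, CFC.negPart_mul_posPart, zero_sub] using h.symm
  · have hm0 : 0 ≤ m := by
      rw [← CFC.posPart_sub_negPart m hm, h, sub_zero]
      exact CFC.posPart_nonneg m
    exact CStarAlgebra.nonneg_iff_eq_star_mul_self.1 hm0

variable [PartialOrder A] [StarOrderedRing A]

/-- A matrix over a C*-algebra that defines a positive form is of the form `star s * s`. -/
theorem exists_star_mul_of_form_nonneg {n : ℕ} (a : Fin n → Fin n → A)
    (ha : ∀ c : Fin n → A, 0 ≤ ∑ i, ∑ j, star (c i) * a i j * c j) :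
    ∃ s : Fin n → Fin n → A, ∀ i j, a i j = ∑ k, star (s k i) * s k j := by
  have hsa : ∀ i j, star (a i j) = a j i := by
    intro i j
    have h := star_form_of_isSelfAdjoint
      (fun c d : Fin n → A => ∑ i, ∑ j, star (c i) * a i j * d j)
      (fun x y z => by simp [mul_add, Finset.sum_add_distrib])
      (fun x y z => by simp [add_mul, Finset.sum_add_distrib])
      (fun c x y => by simp [Finset.smul_sum])
      (fun c x y => by simp [Finset.smul_sum])
      (fun c => (ha c).isSelfAdjoint) (Pi.single i 1) (Pi.single j 1)
    have hs : ∀ i j, ∑ k, ∑ l, star ((Pi.single i 1 : Fin n → A) k) * a k l *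
        (Pi.single j 1 : Fin n → A) l = a i j := by
      intro i j
      rw [Finset.sum_eq_single i, Finset.sum_eq_single j]
      · simp
      · intro l _ hl
        simp [hl]
      · simp
      · intro k _ hk
        simp [hk]
      · simp
    simpa only [hs] using h
  let m : CStarMatrix (Fin n) (Fin n) A := CStarMatrix.ofMatrix (Matrix.of a)
  have hm : ∀ i j, m i j = a i j := fun i j => rfl
  have hmsa : IsSelfAdjoint m := by
    ext i j
    rw [CStarMatrix.star_apply, hm, hm, hsa]
  obtain ⟨p, q, hpsa, hpm, hq, hms⟩ := exists_negPart hmsa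
  -- Test the form on the `k`-th column of the negative part `p`: the value is the `k`-th diagonal
  -- entry of `p m p = -p³ = -q* q`, hence both nonnegative and nonpositive. This forces `q = 0`,
  -- and the C*-identity then gives `p² = 0` and `p = 0`.
  have hdiag : ∀ k, ∑ l, star (q l k) * q l k = 0 := by
    intro k
    have h1 : ∑ l, star (q l k) * q l k = (p * p * p) k k := by
      rw [hq, CStarMatrix.mul_apply]
      simp only [CStarMatrix.star_apply]
    have h2 : (p * m * p) k k = ∑ i, ∑ j, star (p i k) * a i j * p j k := by
      simp only [CStarMatrix.mul_apply, Finset.sum_mul]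
      rw [Finset.sum_comm]
      refine Finset.sum_congr rfl fun i _ => Finset.sum_congr rfl fun j _ => ?_
      rw [← CStarMatrix.star_apply, hpsa, hm]
    have h3 : 0 ≤ (p * m * p) k k := h2 ▸ ha fun i => p i k
    rw [hpm, neg_mul, CStarMatrix.neg_apply, ← h1] at h3
    exact le_antisymm (neg_nonneg.1 h3) (Finset.sum_nonneg fun l _ => star_mul_self_nonneg _)
  have hq0 : q = 0 := by
    ext l k
    have h := (Finset.sum_eq_zero_iff_of_nonneg fun l _ => star_mul_self_nonneg (q l k)).1
      (hdiag k) l (Finset.mem_univ _)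
    exact (CStarRing.star_mul_self_eq_zero_iff _).1 h
  have hp3' : p * p * p = 0 := by rw [hq, hq0, mul_zero]
  have hpp : p * p = 0 := by
    have h : star (p * p) * (p * p) = 0 := by
      rw [star_mul, hpsa, ← mul_assoc, hp3', zero_mul]
    exact (CStarRing.star_mul_self_eq_zero_iff _).1 h
  have hp0 : p = 0 := by
    refine (CStarRing.star_mul_self_eq_zero_iff _).1 ?_
    rw [hpsa, hpp]
  obtain ⟨s, hs⟩ := hms hp0
  refine ⟨fun k i => s k i, fun i j => ?_⟩
  rw [← hm, hs, CStarMatrix.mul_apply]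
  simp only [CStarMatrix.star_apply]

end Matrices

/-! ### Positive kernels and their dilations -/

section PositiveKernels

variable {B : Type u} [CStarAlgebra B]

/-- The part of the definition of an `α`-CPD-kernel that is needed for a realization. -/
structure IsPositiveKernel {S : Type w} {A : Type v} [CStarAlgebra A] [PartialOrder A]
    [StarOrderedRing A] (α : B ≃⋆ₐ[ℂ] B) (J : S → S → B →ₗ[ℂ] A) : Prop where
  nonneg (n : ℕ) (σ : Fin n → S) (b : Fin n → B) (c : Fin n → A) :
    0 ≤ ∑ i, ∑ j, star (c i) * J (σ i) (σ j) (star (α (b i)) * b j) * c j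
  map_aut (σ σ' : S) (b : B) : J σ σ' (α b) = J σ σ' b
  bounded (σ : S) : ∃ M : ℝ, ∀ b, ‖J σ σ b‖ ≤ M * ‖b‖

variable {H : Type v} [NormedAddCommGroup H] [InnerProductSpace ℂ H] [CompleteSpace H]
  {C : VonNeumannAlgebra H} {S : Type w} {α : B ≃⋆ₐ[ℂ] B}
  {J : S → S → B →ₗ[ℂ] C.toStarSubalgebra}

/-- The operators `K^{σ,σ'}(α(b)* b')`. -/
noncomputable def gram (α : B ≃⋆ₐ[ℂ] B) (J : S → S → B →ₗ[ℂ] C.toStarSubalgebra)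
    (x y : B × S) : H →L[ℂ] H :=
  (J x.2 y.2 (star (α x.1) * y.1) : H →L[ℂ] H)

theorem gram_apply (x y : B × S) :
    gram α J x y = (J x.2 y.2 (star (α x.1) * y.1) : H →L[ℂ] H) := rfl

namespace IsPositiveKernel

theorem exists_factorization (hJ : IsPositiveKernel α J) {n : ℕ} (x : Fin n → B × S) :
    ∃ s : Fin n → Fin n → C.toStarSubalgebra,
      ∀ i j, J (x i).2 (x j).2 (star (α (x i).1) * (x j).1) = ∑ k, star (s k i) * s k j :=
  exists_star_mul_of_form_nonneg _ fun c => hJ.nonneg n (fun i => (x i).2) (fun i => (x i).1) c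

/-- Positivity on two points suffices: the entries of a matrix `s* s` are Hermitian. Hence
`IsPositiveKernel` needs no separate symmetry condition. -/
theorem star_apply (hJ : IsPositiveKernel α J) (x y : B × S) :
    star (J x.2 y.2 (star (α x.1) * y.1)) = J y.2 x.2 (star (α y.1) * x.1) := by
  obtain ⟨s, hs⟩ := hJ.exists_factorization ![x, y]
  have h1 := hs 0 1
  have h2 := hs 1 0
  simp only [Matrix.cons_val_zero, Matrix.cons_val_one] at h1 h2
  rw [h1, h2, star_sum]
  simp only [star_mul, star_star]

/-- The vectors `h i` need not have the form `c i h` with `c i ∈ C`, so the `C`-valued positivity is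
not directly applicable. Factoring the matrix as `s* s` turns the sum into a sum of squared norms.
-/
theorem re_sum_nonneg_fin (hJ : IsPositiveKernel α J) {n : ℕ} (x : Fin n → B × S)
    (h : Fin n → H) :
    0 ≤ (∑ i, ∑ j, inner ℂ (h i) (gram α J (x i) (x j) (h j))).re := by
  obtain ⟨s, hs⟩ := hJ.exists_factorization x
  have key : ∑ i, ∑ j, inner ℂ (h i) (gram α J (x i) (x j) (h j)) =
      ∑ k, inner ℂ (∑ i, (s k i : H →L[ℂ] H) (h i)) (∑ i, (s k i : H →L[ℂ] H) (h i)) := by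
    have h1 : ∀ i j, inner ℂ (h i) (gram α J (x i) (x j) (h j)) =
        ∑ k, inner ℂ ((s k i : H →L[ℂ] H) (h i)) ((s k j : H →L[ℂ] H) (h j)) := by
      intro i j
      have h2 : gram α J (x i) (x j) = ∑ k, (ContinuousLinearMap.adjoint (s k i : H →L[ℂ] H)).comp
          (s k j : H →L[ℂ] H) := by
        rw [gram_apply, hs]
        simp [ContinuousLinearMap.star_eq_adjoint]
        rfl
      rw [h2, sum_apply, inner_sum]
      refine Finset.sum_congr rfl fun k _ => ?_
      rw [ContinuousLinearMap.comp_apply, ContinuousLinearMap.adjoint_inner_right]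
    have h3 : ∀ k, inner ℂ (∑ i, (s k i : H →L[ℂ] H) (h i)) (∑ i, (s k i : H →L[ℂ] H) (h i)) =
        ∑ i, ∑ j, inner ℂ ((s k i : H →L[ℂ] H) (h i)) ((s k j : H →L[ℂ] H) (h j)) := fun k => by
      rw [sum_inner]
      exact Finset.sum_congr rfl fun i _ => inner_sum _ _ _
    simp only [h1, h3]
    refine Eq.trans ?_ Finset.sum_comm
    exact Finset.sum_congr rfl fun i _ => Finset.sum_comm
  rw [key, Complex.re_sum]
  exact Finset.sum_nonneg fun k _ => inner_self_nonneg (𝕜 := ℂ)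

theorem re_sum_nonneg (hJ : IsPositiveKernel α J) (t : Finset (B × S)) (h : B × S → H) :
    0 ≤ (∑ x ∈ t, ∑ y ∈ t, inner ℂ (h x) (gram α J x y (h y))).re := by
  have h1 := hJ.re_sum_nonneg_fin (fun i => (t.equivFin.symm i : B × S))
    (fun i => h (t.equivFin.symm i))
  have h2 : ∀ f : B × S → ℂ, ∑ i, f (t.equivFin.symm i) = ∑ x ∈ t, f x := fun f => by
    rw [t.equivFin.symm.sum_comp (fun x => f x), Finset.sum_coe_sort]
  have h3 : ∀ x, ∑ j, inner ℂ (h x) (gram α J x (t.equivFin.symm j) (h (t.equivFin.symm j))) =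
      ∑ y ∈ t, inner ℂ (h x) (gram α J x y (h y)) :=
    fun x => h2 fun y => inner ℂ (h x) (gram α J x y (h y))
  simp only [h3] at h1
  rwa [h2 (fun x => ∑ y ∈ t, inner ℂ (h x) (gram α J x y (h y)))] at h1

theorem gram_posSemidef (hJ : IsPositiveKernel α J) : (Matrix.of (gram α J)).PosSemidef := by
  have htfae := (RKHS.posSemidef_tfae (K := Matrix.of (gram α J))).out 0 2
  refine htfae.2 ⟨?_, fun f => ?_⟩
  · ext1 x y
    exact congrArg Subtype.val (hJ.star_apply y x)
  · have h := hJ.re_sum_nonneg f.support f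
    rw [Finset.sum_comm] at h
    rw [← Complex.conj_re] at h
    simp only [map_sum, inner_conj_symm] at h
    exact h

end IsPositiveKernel

variable (C α J) in
/-- A Hilbert space `G` with operators `V b s : H → G` whose inner products are given by the
kernel `J`. -/
structure Dilation where
  /-- The Hilbert space. -/
  G : Type t
  [normedAddCommGroup : NormedAddCommGroup G]
  [innerProductSpace : InnerProductSpace ℂ G]
  [completeSpace : CompleteSpace G]
  /-- The operators. -/
  V : B → S → H →L[ℂ] G
  adjoint_comp (b b' : B) (s s' : S) : (ContinuousLinearMap.adjoint (V b s)).comp (V b' s') =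
    (J s s' (star (α b) * b') : H →L[ℂ] H)
  total : (Submodule.span ℂ (Set.range fun x : (B × S) × H => V x.1.1 x.1.2 x.2)
    ).topologicalClosure = ⊤

/-- Kolmogorov decomposition: `G` is the reproducing kernel Hilbert space of `gram α J` on `B × S`,
and `V b s` is its kernel function at `(b, s)`. -/
theorem IsPositiveKernel.nonempty_dilation (hJ : IsPositiveKernel α J) :
    Nonempty (Dilation.{u, v, w, max u v w} C α J) := by
  have := Fact.mk hJ.gram_posSemidef
  refine ⟨⟨RKHS.OfKernel (Matrix.of (gram α J)), fun b s => RKHS.kerFun _ (b, s),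
    fun b b' s s' => ?_, ?_⟩⟩
  · rw [← RKHS.kernel_apply, RKHS.OfKernel.kernel_ofKernel, Matrix.of_apply, gram_apply]
  · rw [← RKHS.kerFun_dense (RKHS.OfKernel (Matrix.of (gram α J)))]
    congr 2
    ext g
    simp

end PositiveKernels

/-! ### The S-correspondence of a dilation -/

namespace Dilation

attribute [instance] normedAddCommGroup innerProductSpace completeSpace

variable {B : Type u} [CStarAlgebra B]
  {H : Type v} [NormedAddCommGroup H] [InnerProductSpace ℂ H] [CompleteSpace H]
  {C : VonNeumannAlgebra H} {S : Type w} {α : B ≃⋆ₐ[ℂ] B}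
  {J : S → S → B →ₗ[ℂ] C.toStarSubalgebra}

section Basic

variable (D : Dilation.{u, v, w, t} C α J)

theorem inner_V (b b' : B) (s s' : S) (h h' : H) : inner ℂ (D.V b s h) (D.V b' s' h') =
    inner ℂ h ((J s s' (star (α b) * b') : H →L[ℂ] H) h') := by
  rw [← D.adjoint_comp, ContinuousLinearMap.comp_apply, ContinuousLinearMap.adjoint_inner_right]

theorem ext_inner {x y : D.G}
    (h : ∀ b s k, inner ℂ (D.V b s k) x = inner ℂ (D.V b s k) y) : x = y :=
  eq_of_forall_inner D.total fun _ => h _ _ _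

theorem ext_clm {F : Type*} [NormedAddCommGroup F] [NormedSpace ℂ F] {P Q : D.G →L[ℂ] F}
    (h : ∀ b s k, P (D.V b s k) = Q (D.V b s k)) : P = Q :=
  clm_ext D.total fun _ => h _ _ _

theorem V_add (b b' : B) (s : S) (h : H) : D.V (b + b') s h = D.V b s h + D.V b' s h :=
  D.ext_inner fun c s k => by simp [inner_V, mul_add]

theorem V_smul (z : ℂ) (b : B) (s : S) (h : H) : D.V (z • b) s h = z • D.V b s h :=
  D.ext_inner fun c s k => by simp [inner_V]

theorem norm_V_sq (b : B) (s : S) : ‖D.V b s‖ ^ 2 = ‖J s s (star (α b) * b)‖ := by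
  have h := congrArg norm (D.adjoint_comp b b s s)
  rw [ContinuousLinearMap.norm_adjoint_comp_self, ← sq] at h
  exact h

/-- Formal adjointness of `d` and `d*` on the vectors holds because the values of `J` lie in `C`.
The iterates apply powers of `e = d* d`; the `+ 1` in the rate keeps it positive when `e = 0`. -/
theorem exists_op (d : C.commutant) : ∃ T : D.G →L[ℂ] D.G,
    (∀ b s h, T (D.V b s h) = D.V b s ((d : H →L[ℂ] H) h)) ∧
    ∀ b s h, ContinuousLinearMap.adjoint T (D.V b s h) =
      D.V b s (((star d : C.commutant) : H →L[ℂ] H) h) := by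
  let e : H →L[ℂ] H := ((star d : C.commutant) : H →L[ℂ] H) * (d : H →L[ℂ] H)
  have hd : ((star d : C.commutant) : H →L[ℂ] H) = ContinuousLinearMap.adjoint (d : H →L[ℂ] H) :=
    rfl
  obtain ⟨T, hT, hT'⟩ := exists_operator D.total
    (f := fun x => (x.1, (d : H →L[ℂ] H) x.2))
    (g := fun x => (x.1, ((star d : C.commutant) : H →L[ℂ] H) x.2)) (M := ‖e‖ + 1)
    (fun x y => by
      simp only [inner_V]
      rw [CommutantRep.commute_of_mem (J x.1.2 y.1.2 _).2 (star d).2, hd,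
        ContinuousLinearMap.adjoint_inner_right])
    (by positivity)
    (fun x => by
      refine ⟨‖D.V x.1.1 x.1.2‖ * ‖x.2‖, fun n => ?_⟩
      have h1 : ∀ n, ((fun x : (B × S) × H => (x.1, ((star d : C.commutant) : H →L[ℂ] H) x.2)) ∘
          fun x => (x.1, (d : H →L[ℂ] H) x.2))^[n] x = (x.1, (e ^ n) x.2) := by
        intro n
        induction n with
        | zero => rfl
        | succ n ih => rw [Function.iterate_succ_apply', ih, pow_succ']; rfl
      rw [h1]
      calc ‖D.V x.1.1 x.1.2 ((e ^ n) x.2)‖ ≤ ‖D.V x.1.1 x.1.2‖ * (‖e ^ n‖ * ‖x.2‖) :=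
            (ContinuousLinearMap.le_opNorm _ _).trans
              (mul_le_mul_of_nonneg_left (ContinuousLinearMap.le_opNorm _ _) (norm_nonneg _))
        _ ≤ ‖D.V x.1.1 x.1.2‖ * ((‖e‖ + 1) ^ n * ‖x.2‖) := by
            gcongr
            refine le_trans ?_ (pow_le_pow_left₀ (norm_nonneg e) (by linarith) n)
            rcases n.eq_zero_or_pos with rfl | hn
            · rw [pow_zero, pow_zero]
              exact ContinuousLinearMap.norm_id_le
            · exact norm_pow_le' e hn
        _ = _ := by ring)
  exact ⟨T, fun b s h => hT ((b, s), h), fun b s h => hT' ((b, s), h)⟩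

/-- The representation of the commutant on a dilation. -/
noncomputable def rep : CommutantRep C D.G where
  op d := (D.exists_op d).choose
  adjoint_op d := D.ext_clm fun b s h => by
    rw [(D.exists_op d).choose_spec.2, (D.exists_op (star d)).choose_spec.1]

theorem rep_V (d : C.commutant) (b : B) (s : S) (h : H) :
    D.rep.op d (D.V b s h) = D.V b s ((d : H →L[ℂ] H) h) :=
  (D.exists_op d).choose_spec.1 b s h

end Basic

variable (hJ : IsPositiveKernel α J) (D : Dilation.{u, v, w, t} C α J)
include hJ

theorem exists_norm_V_le (s : S) : ∃ K : ℝ, ∀ b, ‖D.V b s‖ ≤ K * ‖b‖ := by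
  obtain ⟨M, hM⟩ := hJ.bounded s
  refine ⟨√|M|, fun b => ?_⟩
  have h1 : ‖D.V b s‖ ^ 2 ≤ |M| * ‖b‖ ^ 2 := by
    rw [D.norm_V_sq]
    calc _ ≤ M * ‖star (α b) * b‖ := hM _
      _ ≤ |M| * ‖star (α b) * b‖ := mul_le_mul_of_nonneg_right (le_abs_self M) (norm_nonneg _)
      _ ≤ |M| * (‖star (α b)‖ * ‖b‖) := mul_le_mul_of_nonneg_left (norm_mul_le _ _) (abs_nonneg M)
      _ = |M| * ‖b‖ ^ 2 := by rw [norm_star, NonUnitalStarAlgHom.norm_map α α.injective, sq]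
  rw [← Real.sqrt_sq (norm_nonneg b), ← Real.sqrt_mul (abs_nonneg M)]
  exact Real.le_sqrt_of_sq_le h1

/-- Invariance of `J` under `α` makes `α` and its inverse formally adjoint. Their composite is the
identity, so rate `1` suffices. -/
theorem exists_unitary : ∃ T : D.G →L[ℂ] D.G,
    (∀ b s h, T (D.V b s h) = D.V (α b) s h) ∧
    ∀ b s h, ContinuousLinearMap.adjoint T (D.V b s h) = D.V (α.symm b) s h := by
  obtain ⟨T, hT, hT'⟩ := exists_operator D.total
    (f := fun x => ((α x.1.1, x.1.2), x.2)) (g := fun x => ((α.symm x.1.1, x.1.2), x.2)) (M := 1)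
    (fun x y => by
      simp only [inner_V]
      rw [← hJ.map_aut _ _ (star (α x.1.1) * α.symm y.1.1), map_mul α, map_star α,
        StarAlgEquiv.apply_symm_apply])
    one_pos
    (fun x => by
      refine ⟨‖D.V x.1.1 x.1.2 x.2‖, fun n => ?_⟩
      have h1 : ((fun x : (B × S) × H => ((α.symm x.1.1, x.1.2), x.2)) ∘
          fun x => ((α x.1.1, x.1.2), x.2)) = id := by
        funext x
        simp
      rw [h1]
      simp)
  exact ⟨T, fun b s h => hT ((b, s), h), fun b s h => hT' ((b, s), h)⟩

/-- The twist in the Gram kernel makes left multiplication by `α(c)*` the formal adjoint of that by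
`c`. Iterates multiply `b` by powers of `α(c)* c`, and `‖V b s‖` is bounded by a multiple of `‖b‖`,
so the growth is exponential with a rate depending on `c` only. -/
theorem exists_leftMul (c : B) : ∃ T : D.G →L[ℂ] D.G,
    (∀ b s h, T (D.V b s h) = D.V (c * b) s h) ∧
    ∀ b s h, ContinuousLinearMap.adjoint T (D.V b s h) = D.V (star (α c) * b) s h := by
  obtain ⟨T, hT, hT'⟩ := exists_operator D.total
    (f := fun x => ((c * x.1.1, x.1.2), x.2)) (g := fun x => ((star (α c) * x.1.1, x.1.2), x.2))
    (M := ‖star (α c) * c‖ + 1)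
    (fun x y => by
      simp only [inner_V]
      rw [map_mul α, star_mul, mul_assoc])
    (by positivity)
    (fun x => by
      obtain ⟨K, hK⟩ := D.exists_norm_V_le hJ x.1.2
      refine ⟨|K| * ‖x.1.1‖ * ‖x.2‖, fun n => ?_⟩
      have h1 : ∀ n, ((fun x : (B × S) × H => ((star (α c) * x.1.1, x.1.2), x.2)) ∘
          fun x => ((c * x.1.1, x.1.2), x.2))^[n] x =
            (((star (α c) * c) ^ n * x.1.1, x.1.2), x.2) := by
        intro n
        induction n with
        | zero => simp
        | succ n ih =>
          rw [Function.iterate_succ_apply', ih, pow_succ']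
          simp only [Function.comp_apply, mul_assoc]
      rw [h1]
      have h2 : ‖(star (α c) * c) ^ n * x.1.1‖ ≤ (‖star (α c) * c‖ + 1) ^ n * ‖x.1.1‖ := by
        rcases n.eq_zero_or_pos with rfl | hn
        · simp
        · refine (norm_mul_le _ _).trans (mul_le_mul_of_nonneg_right ?_ (norm_nonneg _))
          exact (norm_pow_le' _ hn).trans (pow_le_pow_left₀ (norm_nonneg _) (by linarith) n)
      calc _ ≤ ‖D.V ((star (α c) * c) ^ n * x.1.1) x.1.2‖ * ‖x.2‖ :=
            ContinuousLinearMap.le_opNorm _ _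
        _ ≤ |K| * ((‖star (α c) * c‖ + 1) ^ n * ‖x.1.1‖) * ‖x.2‖ := by
            refine mul_le_mul_of_nonneg_right ?_ (norm_nonneg _)
            exact (hK _).trans (mul_le_mul (le_abs_self K) h2 (norm_nonneg _) (abs_nonneg K))
        _ = _ := by ring)
  exact ⟨T, fun b s h => hT ((b, s), h), fun b s h => hT' ((b, s), h)⟩

/-- The unitary on a dilation that implements the automorphism. -/
noncomputable def unitary : D.G →L[ℂ] D.G := (D.exists_unitary hJ).choose

theorem unitary_V (b : B) (s : S) (h : H) : D.unitary hJ (D.V b s h) = D.V (α b) s h :=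
  (D.exists_unitary hJ).choose_spec.1 b s h

theorem adjoint_unitary_V (b : B) (s : S) (h : H) :
    ContinuousLinearMap.adjoint (D.unitary hJ) (D.V b s h) = D.V (α.symm b) s h :=
  (D.exists_unitary hJ).choose_spec.2 b s h

/-- The left multiplications on a dilation. -/
noncomputable def leftMul : B →ₐ[ℂ] D.G →L[ℂ] D.G :=
  have hV : ∀ c b s h, (D.exists_leftMul hJ c).choose (D.V b s h) = D.V (c * b) s h :=
    fun c => (D.exists_leftMul hJ c).choose_spec.1
  AlgHom.ofLinearMap
    { toFun := fun c => (D.exists_leftMul hJ c).choose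
      map_add' := fun c c' => D.ext_clm fun b s h => by
        rw [add_apply, hV, hV, hV, add_mul, V_add]
      map_smul' := fun z c => D.ext_clm fun b s h => by
        rw [RingHom.id_apply, smul_apply, hV, hV, smul_mul_assoc, V_smul] }
    (D.ext_clm fun b s h => (hV 1 b s h).trans (by rw [one_mul]; rfl))
    (fun c c' => D.ext_clm fun b s h => by
      refine (hV _ b s h).trans ?_
      rw [mul_assoc, ← hV, ← hV]
      rfl)

theorem leftMul_V (c b : B) (s : S) (h : H) : D.leftMul hJ c (D.V b s h) = D.V (c * b) s h :=
  (D.exists_leftMul hJ c).choose_spec.1 b s h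

theorem adjoint_leftMul_V (c b : B) (s : S) (h : H) :
    ContinuousLinearMap.adjoint (D.leftMul hJ c) (D.V b s h) = D.V (star (α c) * b) s h :=
  (D.exists_leftMul hJ c).choose_spec.2 b s h

theorem unitary_rep (d : C.commutant) (g : D.G) :
    D.unitary hJ (D.rep.op d g) = D.rep.op d (D.unitary hJ g) :=
  congrArg (fun T : D.G →L[ℂ] D.G => T g) (D.ext_clm (P := (D.unitary hJ).comp (D.rep.op d))
    (Q := (D.rep.op d).comp (D.unitary hJ)) fun b s h => by simp [rep_V, unitary_V])

theorem leftMul_rep (c : B) (d : C.commutant) (g : D.G) :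
    D.leftMul hJ c (D.rep.op d g) = D.rep.op d (D.leftMul hJ c g) :=
  congrArg (fun T : D.G →L[ℂ] D.G => T g) (D.ext_clm (P := (D.leftMul hJ c).comp (D.rep.op d))
    (Q := (D.rep.op d).comp (D.leftMul hJ c)) fun b s h => by simp [rep_V, leftMul_V])

theorem adjoint_unitary_unitary (g : D.G) :
    ContinuousLinearMap.adjoint (D.unitary hJ) (D.unitary hJ g) = g :=
  congrArg (fun T : D.G →L[ℂ] D.G => T g) (D.ext_clm
    (P := (ContinuousLinearMap.adjoint (D.unitary hJ)).comp (D.unitary hJ))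
    (Q := ContinuousLinearMap.id ℂ D.G) fun b s h => by simp [unitary_V, adjoint_unitary_V])

theorem unitary_adjoint_unitary (g : D.G) :
    D.unitary hJ (ContinuousLinearMap.adjoint (D.unitary hJ) g) = g :=
  congrArg (fun T : D.G →L[ℂ] D.G => T g) (D.ext_clm
    (P := (D.unitary hJ).comp (ContinuousLinearMap.adjoint (D.unitary hJ)))
    (Q := ContinuousLinearMap.id ℂ D.G) fun b s h => by simp [unitary_V, adjoint_unitary_V])

theorem adjoint_leftMul_unitary (c : B) (g : D.G) :
    ContinuousLinearMap.adjoint (D.leftMul hJ c) (D.unitary hJ g) =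
      D.unitary hJ (D.leftMul hJ (star c) g) :=
  congrArg (fun T : D.G →L[ℂ] D.G => T g) (D.ext_clm
    (P := (ContinuousLinearMap.adjoint (D.leftMul hJ c)).comp (D.unitary hJ))
    (Q := (D.unitary hJ).comp (D.leftMul hJ (star c))) fun b s h => by
      simp [unitary_V, leftMul_V, adjoint_leftMul_V, map_star])

/-- The S-correspondence of a dilation. -/
noncomputable def correspondence : SCorrespondence.{u, v, max v t} B C.toStarSubalgebra :=
  D.rep.correspondence (D.unitary hJ) (D.unitary_rep hJ) (D.adjoint_unitary_unitary hJ)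
    (D.unitary_adjoint_unitary hJ) (D.leftMul hJ) (D.leftMul_rep hJ) (D.adjoint_leftMul_unitary hJ)

/-- The intertwiner `h ↦ V b s h`. -/
noncomputable def vec (b : B) (s : S) : (D.correspondence hJ).E :=
  D.rep.ofMem (D.V b s) fun d h => (D.rep_V d b s h).symm

theorem ip_vec (b b' : B) (s s' : S) :
    HilbertModule.ip (A := C.toStarSubalgebra) (D.vec hJ b s) (D.vec hJ b' s') =
      J s s' (star (α b) * b') :=
  Subtype.ext (D.adjoint_comp b b' s s')

theorem π_vec (c b : B) (s : S) :
    ((D.correspondence hJ).π c : (D.correspondence hJ).E →L[ℂ] (D.correspondence hJ).E)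
      (D.vec hJ b s) = D.vec hJ (c * b) s :=
  D.rep.intertwiner_ext fun h => D.leftMul_V hJ c b s h

theorem U_vec (b : B) (s : S) : (D.correspondence hJ).U (D.vec hJ b s) = D.vec hJ (α b) s :=
  D.rep.intertwiner_ext fun h => D.unitary_V hJ b s h

theorem isVonNeumannModule (D : Dilation.{u, v, w, max v t} C α J) :
    IsVonNeumannModule C (D.correspondence hJ).E := by
  refine D.rep.isVonNeumannModule (top_le_iff.1 ?_)
  rw [← D.total]
  refine Submodule.topologicalClosure_mono (Submodule.span_mono ?_)
  rintro _ ⟨x, rfl⟩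
  exact ⟨D.vec hJ x.1.1 x.1.2, x.2, rfl⟩

end Dilation

/-! ### The kernels realized in an S-correspondence -/

section HilbertModules

open HilbertModule

variable {A : Type v} [CStarAlgebra A] [PartialOrder A] [StarOrderedRing A]
  {E : Type w} [NormedAddCommGroup E] [NormedSpace ℂ E] [CompleteSpace E] [Module Aᵐᵒᵖ E]
  [HilbertModule A E]

theorem op_smul_ip (x y : E) (a : A) :
    ip (A := A) (MulOpposite.op a • x) y = star a * ip x y := by
  rw [← star_ip, ip_op_smul, star_mul, star_ip]

theorem ip_sum {n : ℕ} (x : E) (y : Fin n → E) :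
    ip (A := A) x (∑ i, y i) = ∑ i, ip (A := A) x (y i) :=
  map_sum (AddMonoidHom.mk' (ip (A := A) x) (ip_add x)) y _

theorem sum_ip {n : ℕ} (x : Fin n → E) (y : E) :
    ip (A := A) (∑ i, x i) y = ∑ i, ip (A := A) (x i) y :=
  map_sum (AddMonoidHom.mk' (fun x => ip (A := A) x y) fun x x' => ip_add_left A x x' y) x _

variable (A) in
theorem ip_sub_self (x y : E) : ip (A := A) (x - y) (x - y) =
    ip x x - ip x y - ip y x + ip y y := by
  have h : x - y = x + (-1 : ℂ) • y := by rw [neg_one_smul, sub_eq_add_neg]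
  rw [h, ip_add, ip_add_left, ip_add_left, ip_smul, ip_smul, ip_smul_left, ip_smul_left]
  simp only [star_neg, star_one, neg_smul, one_smul, neg_neg]
  abel

variable (A) in
/-- The distance of two vectors is determined by their inner products. -/
theorem enorm_sub_eq_of_ip {E' : Type t} [NormedAddCommGroup E'] [NormedSpace ℂ E']
    [CompleteSpace E'] [Module Aᵐᵒᵖ E'] [HilbertModule A E'] {x y : E} {x' y' : E'}
    (hxx : ip (A := A) x x = ip x' x') (hxy : ip (A := A) x y = ip x' y')
    (hyy : ip (A := A) y y = ip y' y') : ‖x - y‖ₑ = ‖x' - y'‖ₑ := by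
  have hyx : ip (A := A) y x = ip y' x' := by rw [← star_ip, hxy, star_ip]
  rw [enorm_eq_iff_norm_eq, norm_eq (A := A) (x - y), norm_eq (A := A) (x' - y'), ip_sub_self,
    ip_sub_self, hxx, hxy, hyx, hyy]

end HilbertModules

namespace SCorrespondence

open HilbertModule

variable {B : Type u} [CStarAlgebra B] {A : Type v} [CStarAlgebra A] [PartialOrder A]
  [StarOrderedRing A] (F : SCorrespondence.{u, v, t} B A)

/-- The left action of `B`. -/
noncomputable def act (b : B) : F.E →L[ℂ] F.E := F.π b

theorem act_mul (b b' : B) (x : F.E) : F.act (b * b') x = F.act b (F.act b' x) := by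
  simp [act]

theorem act_one (x : F.E) : F.act 1 x = x := by
  simp [act]

theorem ip_U_U (x y : F.E) : ip (A := A) (F.U x) (F.U y) = ip x y := by
  rw [F.ip_U, LinearEquiv.symm_apply_apply]

variable {S : Type w} (α : B ≃⋆ₐ[ℂ] B)

/-- The maps `i` into an S-correspondence such that `U` implements `α` on the vectors
`b i(σ)`. -/
def IsCovariant (i : S → F.E) : Prop :=
  ∀ s b, F.U (F.act b (i s)) = F.act (α b) (i s)

/-- The kernel `⟨i(σ), b i(σ')⟩`. -/
noncomputable def kernel (i : S → F.E) (s s' : S) : B →ₗ[ℂ] A where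
  toFun b := ip (i s) (F.act b (i s'))
  map_add' b b' := by simp [act, ip_add]
  map_smul' z b := by simp [act, ip_smul]

theorem kernel_apply (i : S → F.E) (s s' : S) (b : B) :
    F.kernel i s s' b = ip (i s) (F.act b (i s')) := rfl

variable {F α} {i : S → F.E} (hi : F.IsCovariant α i)
include hi

theorem IsCovariant.U_apply (s : S) : F.U (i s) = i s := by
  have h := hi s 1
  rwa [map_one, act_one] at h

/-- Apply `U` to both sides: it turns `b` into `α(b)`, and the `U`-representation property moves
`α(b)` across as `α(b)*`. Then `U` is removed using `U i(s) = i(s)`. -/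
theorem IsCovariant.ip_act_left (s : S) (b : B) (z : F.E) :
    ip (A := A) (F.act b (i s)) z = ip (i s) (F.act (star (α b)) z) := by
  rw [← F.ip_U_U, hi]
  refine (F.ip_π _ _ _).trans ?_
  conv_lhs => rw [← hi.U_apply s]
  exact F.ip_U_U _ _

theorem IsCovariant.ip_act_act (s s' : S) (b b' : B) :
    ip (A := A) (F.act b (i s)) (F.act b' (i s')) = F.kernel i s s' (star (α b) * b') := by
  rw [hi.ip_act_left, kernel_apply, act_mul]

theorem IsCovariant.kernel_map_aut (s s' : S) (b : B) :
    F.kernel i s s' (α b) = F.kernel i s s' b := by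
  rw [kernel_apply, ← hi s' b]
  conv_lhs => rw [← hi.U_apply s]
  exact F.ip_U_U _ _

/-- The kernel of a covariant map is positive if its diagonal is bounded. -/
theorem IsCovariant.isPositiveKernel
    (hb : ∀ s, ∃ M : ℝ, ∀ b, ‖F.kernel i s s b‖ ≤ M * ‖b‖) :
    IsPositiveKernel α (F.kernel i) where
  nonneg n σ b c := by
    -- The sum to be estimated is `⟨x, x⟩` for `x = ∑ b_j i(σ_j) c_j`.
    have h := ip_self_nonneg (A := A) (∑ j, MulOpposite.op (c j) • F.act (b j) (i (σ j)))
    rw [sum_ip] at h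
    simpa only [ip_sum, op_smul_ip, ip_op_smul, hi.ip_act_act, mul_assoc] using h
  map_aut := hi.kernel_map_aut
  bounded := hb

/-- A covariant map realizes its kernel. -/
theorem IsCovariant.mem_realizations {K : S → S → B →L[ℂ] A}
    (hK : ∀ σ σ' b, F.kernel i σ σ' b = K σ σ' b) :
    i ∈ F.realizations α K := by
  refine ⟨fun σ σ' b => (hK σ σ' b).symm, fun σ σ' b => ?_, hi⟩
  have h := hi.ip_act_act σ σ' (α (star b)) 1
  have hα : star (α (α (star b))) = α (α b) := by rw [map_star α, map_star α, star_star]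
  rw [act_one, mul_one, hα, hi.kernel_map_aut, hi.kernel_map_aut, hK] at h
  exact h.symm

end SCorrespondence

/-! ### Operations on kernels -/

section Operations

variable {B : Type u} [CStarAlgebra B] {A : Type v} [CStarAlgebra A] {α : B ≃⋆ₐ[ℂ] B}

open Classical in
/-- The block diagonal sum of a family of kernels. -/
noncomputable def blockKernel {Λ : Type t} {T : Type w} (J : Λ → T → T → B →ₗ[ℂ] A)
    (x y : Λ × T) : B →ₗ[ℂ] A :=
  if x.1 = y.1 then J x.1 x.2 y.2 else 0

theorem blockKernel_same {Λ : Type t} {T : Type w} (J : Λ → T → T → B →ₗ[ℂ] A) (l : Λ) (x y : T) :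
    blockKernel J (l, x) (l, y) = J l x y := if_pos rfl

theorem blockKernel_of_ne {Λ : Type t} {T : Type w} (J : Λ → T → T → B →ₗ[ℂ] A) {l l' : Λ}
    (h : l ≠ l') (x y : T) : blockKernel J (l, x) (l', y) = 0 := if_neg h

variable [PartialOrder A] [StarOrderedRing A]

theorem IsCPDKernel.isPositiveKernel {Ω : Type w} {K : Ω → Ω → B →L[ℂ] A}
    (hK : IsCPDKernel α K) :
    IsPositiveKernel α fun σ σ' => (K σ σ' : B →ₗ[ℂ] A) where
  nonneg := hK.nonneg
  map_aut := hK.map_aut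
  bounded σ := ⟨‖K σ σ‖, (K σ σ).le_opNorm⟩

theorem IsPositiveKernel.comap {S T : Type w} {J : S → S → B →ₗ[ℂ] A} (hJ : IsPositiveKernel α J)
    (f : T → S) : IsPositiveKernel α fun t t' => J (f t) (f t') where
  nonneg n σ := hJ.nonneg n fun i => f (σ i)
  map_aut _ _ := hJ.map_aut _ _
  bounded _ := hJ.bounded _

open Classical in
theorem IsPositiveKernel.blockKernel {Λ : Type t} {T : Type w} {J : Λ → T → T → B →ₗ[ℂ] A}
    (hJ : ∀ l, IsPositiveKernel α (J l)) : IsPositiveKernel α (blockKernel J) where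
  nonneg n σ b c := by
    -- Split by block: in the term of block `l`, the coefficients outside `l` are replaced by zero,
    -- which leaves a full positive sum for `J l`.
    have key : ∑ i, ∑ j, star (c i) * Bures.blockKernel J (σ i) (σ j) (star (α (b i)) * b j) * c j =
        ∑ l ∈ Finset.univ.image fun i => (σ i).1, ∑ i, ∑ j,
          star (if (σ i).1 = l then c i else 0) * J l (σ i).2 (σ j).2 (star (α (b i)) * b j) *
            (if (σ j).1 = l then c j else 0) := by
      refine Eq.trans (Finset.sum_congr rfl fun i _ => ?_) Finset.sum_comm
      refine Eq.trans (Finset.sum_congr rfl fun j _ => ?_) Finset.sum_comm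
      symm
      rw [Finset.sum_eq_single (σ i).1]
      · by_cases h : (σ i).1 = (σ j).1
        · simp [Bures.blockKernel, h]
        · simp [Bures.blockKernel, h, Ne.symm h]
      · intro l _ hl
        simp [hl.symm]
      · intro h
        exact absurd (Finset.mem_image_of_mem _ (Finset.mem_univ i)) h
    rw [key]
    exact Finset.sum_nonneg fun l _ => (hJ l).nonneg n (fun i => (σ i).2) b _
  map_aut x y b := by
    by_cases h : x.1 = y.1
    · simp [Bures.blockKernel, h, (hJ _).map_aut]
    · simp [Bures.blockKernel, h]
  bounded x := by
    simpa [Bures.blockKernel] using (hJ x.1).bounded x.2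

end Operations

namespace Dilation

variable {B : Type u} [CStarAlgebra B]
  {H : Type v} [NormedAddCommGroup H] [InnerProductSpace ℂ H] [CompleteSpace H]
  {C : VonNeumannAlgebra H} {S : Type w} {α : B ≃⋆ₐ[ℂ] B}
  {J : S → S → B →ₗ[ℂ] C.toStarSubalgebra} (D : Dilation.{u, v, w, t} C α J)
  {Ω : Type*} {m : Bool → Ω → S}

/-- Two mutually orthogonal copies of a kernel can be interchanged by a self-adjoint unitary that
commutes with all operators which act on the vectors `V b s h` through `b` and `h`. -/
theorem exists_swap (hm : ∀ t σ σ', J (m t σ) (m t σ') = J (m (!t) σ) (m (!t) σ'))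
    (hm0 : ∀ t σ σ', J (m t σ) (m (!t) σ') = 0) :
    ∃ Z : D.G →L[ℂ] D.G, ContinuousLinearMap.adjoint Z = Z ∧ (∀ g, Z (Z g) = g) ∧
      (∀ t b σ h, Z (D.V b (m t σ) h) = D.V b (m (!t) σ) h) ∧
      ∀ (T : D.G →L[ℂ] D.G) (φ φ' : B → B) (ψ ψ' : H → H),
        (∀ b s h, T (D.V b s h) = D.V (φ b) s (ψ h)) →
        (∀ b s h, ContinuousLinearMap.adjoint T (D.V b s h) = D.V (φ' b) s (ψ' h)) →
          ∀ g, Z (T g) = T (Z g) := by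
  -- `N` is the orthogonal complement of both copies. Adjoined to their vectors it gives a total
  -- family, on which the involution `f` exchanges the copies and fixes `N`.
  let N : Type t := {g : D.G // ∀ t b σ h, inner ℂ (D.V b (m t σ) h) g = 0}
  let v : (Bool × B × Ω × H) ⊕ N → D.G :=
    Sum.elim (fun x => D.V x.2.1 (m x.1 x.2.2.1) x.2.2.2) Subtype.val
  let f : (Bool × B × Ω × H) ⊕ N → (Bool × B × Ω × H) ⊕ N :=
    Sum.map (fun x => (!x.1, x.2)) id
  have hff : f ∘ f = id := by
    funext x
    rcases x with x | x <;> simp [f]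
  have hv : (Submodule.span ℂ (Set.range v)).topologicalClosure = ⊤ := by
    rw [Submodule.topologicalClosure_eq_top_iff, Submodule.eq_bot_iff]
    intro g hg
    have hg' : ∀ i, inner ℂ (v i) g = 0 := fun i =>
      (Submodule.mem_orthogonal _ _).1 hg _ (Submodule.subset_span ⟨i, rfl⟩)
    exact inner_self_eq_zero.1 (hg' (Sum.inr ⟨g, fun t b σ h => hg' (Sum.inl (t, b, σ, h))⟩))
  have hgram : ∀ i j, inner ℂ (v (f i)) (v j) = inner ℂ (v i) (v (f j)) := by
    rintro (⟨t, b, σ, h⟩ | x) (⟨t', b', σ', h'⟩ | y)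
    · simp only [v, f, Sum.map_inl, Sum.elim_inl, inner_V]
      by_cases htt : t = t'
      · subst htt
        rw [hm0]
        have := hm0 (!t) σ σ'
        rw [Bool.not_not] at this
        rw [this]
      · have htt' : t' = !t := by
          cases t <;> cases t' <;> simp_all
        subst htt'
        rw [Bool.not_not, hm t]
    · simp only [v, f, Sum.map_inl, Sum.map_inr, Sum.elim_inl, Sum.elim_inr, id]
      rw [y.2, y.2]
    · simp only [v, f, Sum.map_inl, Sum.map_inr, Sum.elim_inl, Sum.elim_inr, id]
      rw [← inner_conj_symm, x.2, ← inner_conj_symm, x.2]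
    · rfl
  obtain ⟨Z, hZ, hZ'⟩ := exists_operator hv hgram one_pos fun i => ⟨‖v i‖, fun n => by
    rw [hff]
    simp⟩
  have hZm : ∀ t b σ h, Z (D.V b (m t σ) h) = D.V b (m (!t) σ) h :=
    fun t b σ h => hZ (Sum.inl (t, b, σ, h))
  have hZN : ∀ g, (∀ t b σ h, inner ℂ (D.V b (m t σ) h) g = 0) → Z g = g :=
    fun g hg => hZ (Sum.inr ⟨g, hg⟩)
  refine ⟨Z, clm_ext hv fun i => (hZ' i).trans (hZ i).symm, fun g => ?_, hZm,
    fun T φ φ' ψ ψ' hT hT' g => ?_⟩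
  · refine congrArg (fun P : D.G →L[ℂ] D.G => P g)
      (clm_ext hv (S := Z.comp Z) (T := ContinuousLinearMap.id ℂ D.G) fun i => ?_)
    rw [ContinuousLinearMap.comp_apply, hZ, hZ]
    exact congrArg v (congrFun hff i)
  · refine congrArg (fun P : D.G →L[ℂ] D.G => P g)
      (clm_ext hv (S := Z.comp T) (T := T.comp Z) fun i => ?_)
    rcases i with ⟨t, b, σ, h⟩ | x
    · show Z (T (D.V b (m t σ) h)) = T (Z (D.V b (m t σ) h))
      rw [hT, hZm, hZm, hT]
    · show Z (T x.1) = T (Z x.1)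
      rw [hZN x.1 x.2]
      -- `T*` sends each vector of the copies to another such vector, so `T` maps `N` into itself,
      -- where `Z` is the identity.
      refine hZN _ fun t b σ h => ?_
      rw [← ContinuousLinearMap.adjoint_inner_left, hT', x.2]

end Dilation

open HilbertModule

/-! ### The universal S-correspondence -/

namespace Dilation

variable {B : Type u} [CStarAlgebra B]
  {H : Type v} [NormedAddCommGroup H] [InnerProductSpace ℂ H] [CompleteSpace H]
  {C : VonNeumannAlgebra H} {S : Type w} {α : B ≃⋆ₐ[ℂ] B}
  {J : S → S → B →ₗ[ℂ] C.toStarSubalgebra} (hJ : IsPositiveKernel α J)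
  (D : Dilation.{u, v, w, t} C α J)

theorem act_vec (c b : B) (s : S) :
    (D.correspondence hJ).act c (D.vec hJ b s) = D.vec hJ (c * b) s := D.π_vec hJ c b s

theorem isCovariant_vec : (D.correspondence hJ).IsCovariant α (D.vec hJ 1) := fun s b => by
  rw [act_vec, act_vec, U_vec, mul_one, mul_one]

theorem kernel_vec (s s' : S) (b : B) :
    (D.correspondence hJ).kernel (D.vec hJ 1) s s' b = J s s' b := by
  rw [SCorrespondence.kernel_apply, act_vec, ip_vec, map_one, star_one, one_mul, mul_one]

/-- The interchange of two orthogonal copies of a kernel, on the module of a dilation. -/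
theorem exists_swap_vec {Ω : Type*} {m : Bool → Ω → S}
    (hm : ∀ t σ σ', J (m t σ) (m t σ') = J (m (!t) σ) (m (!t) σ'))
    (hm0 : ∀ t σ σ', J (m t σ) (m (!t) σ') = 0) :
    ∃ Z : (D.correspondence hJ).E → (D.correspondence hJ).E,
      (∀ t σ, Z (D.vec hJ 1 (m t σ)) = D.vec hJ 1 (m (!t) σ)) ∧
      (∀ x y, ip (A := C.toStarSubalgebra) (Z x) (Z y) = ip x y) ∧
      (∀ b x, Z ((D.correspondence hJ).act b x) = (D.correspondence hJ).act b (Z x)) ∧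
      ∀ x, Z ((D.correspondence hJ).U x) = (D.correspondence hJ).U (Z x) := by
  obtain ⟨Z, hZ, hZZ, hZm, hZT⟩ := D.exists_swap hm hm0
  have hρ : ∀ d g, Z (D.rep.op d g) = D.rep.op d (Z g) := fun d =>
    hZT (D.rep.op d) id id _ _ (D.rep_V d) fun b s h => by
      rw [D.rep.adjoint_op, rep_V, id]
  have hZZ' : ∀ g, ContinuousLinearMap.adjoint Z (Z g) = g := by
    rw [hZ]
    exact hZZ
  refine ⟨D.rep.lift Z hρ, fun t σ => ?_, fun x y => ?_, fun b x => ?_, fun x => ?_⟩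
  · exact D.rep.intertwiner_ext fun h => hZm t 1 σ h
  · refine (D.rep.ip_lift Z hρ x _).trans (congrArg _ (D.rep.intertwiner_ext fun h => ?_))
    exact hZZ' _
  · exact D.rep.intertwiner_ext fun h => hZT (D.leftMul hJ b) _ _ id id (D.leftMul_V hJ b)
      (D.adjoint_leftMul_V hJ b) _
  · exact D.rep.intertwiner_ext fun h => hZT (D.unitary hJ) _ _ id id (D.unitary_V hJ)
      (D.adjoint_unitary_V hJ) _

end Dilation

theorem SCorrespondence.IsCovariant.comp {B : Type u} [CStarAlgebra B] {A : Type v}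
    [CStarAlgebra A] [PartialOrder A] [StarOrderedRing A] {F : SCorrespondence.{u, v, t} B A}
    {S : Type w} {T : Type*} {α : B ≃⋆ₐ[ℂ] B} {i : S → F.E} (hi : F.IsCovariant α i) (f : T → S) :
    F.IsCovariant α (i ∘ f) := fun t => hi (f t)

section Universal

variable {B : Type u} [CStarAlgebra B]
  {H : Type v} [NormedAddCommGroup H] [InnerProductSpace ℂ H] [CompleteSpace H]

/-- There is an S-correspondence that is a von Neumann module and in which each kernel has a
realization `i₁` such that all distances of realizations of `K₁` and `K₂` in some S-correspondence
are distances of `i₁` from realizations of `K₂`. -/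
theorem exists_universal (C : VonNeumannAlgebra H) (Ω : Type w) (α : B ≃⋆ₐ[ℂ] B) :
    ∃ F : SCorrespondence.{u, v, max u v w} B C.toStarSubalgebra,
      IsVonNeumannModule C F.E ∧
      ∀ K₁ : Ω → Ω → B →L[ℂ] C.toStarSubalgebra, IsCPDKernel α K₁ →
        ∃ i₁ ∈ F.realizations α K₁, ∀ K₂ : Ω → Ω → B →L[ℂ] C.toStarSubalgebra,
          ∀ F' : SCorrespondence.{u, v, max u v w} B C.toStarSubalgebra,
            ∀ j₁ ∈ F'.realizations α K₁, ∀ j₂ ∈ F'.realizations α K₂,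
              ∃ i₂ ∈ F.realizations α K₂, ∀ σ, ‖i₁ σ - i₂ σ‖ₑ = ‖j₁ σ - j₂ σ‖ₑ := by
  -- Indexing by kernels instead of correspondences keeps the universe at `max u v w`. The Boolean
  -- separates the block that holds `i₁` from the one that holds the pair, even if their kernels
  -- coincide.
  let Λ := Bool × {J : Ω ⊕ Ω → Ω ⊕ Ω → B →ₗ[ℂ] C.toStarSubalgebra // IsPositiveKernel α J}
  let J : Λ × (Ω ⊕ Ω) → Λ × (Ω ⊕ Ω) → B →ₗ[ℂ] C.toStarSubalgebra :=
    blockKernel fun l : Λ => l.2.1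
  have hJ : IsPositiveKernel α J := IsPositiveKernel.blockKernel fun l => l.2.2
  obtain ⟨D⟩ := hJ.nonempty_dilation
  refine ⟨D.correspondence hJ, Dilation.isVonNeumannModule.{u, v, max u v w, max u w} hJ D,
    fun K₁ hK₁ => ?_⟩
  -- `K₁` is pulled back along the codiagonal `Ω ⊕ Ω → Ω` to become an admissible block; only its
  -- left half is used.
  let l₁ : Λ := (false, ⟨_, hK₁.isPositiveKernel.comap (Sum.elim id id)⟩)
  have hl₁ : ∀ σ σ' : Ω, J (l₁, Sum.inl σ) (l₁, Sum.inl σ') = (K₁ σ σ' : B →ₗ[ℂ] _) :=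
    fun σ σ' => blockKernel_same _ _ _ _
  refine ⟨fun σ => D.vec hJ 1 (l₁, Sum.inl σ), ?_, fun K₂ F' j₁ hj₁ j₂ hj₂ => ?_⟩
  · refine ((D.isCovariant_vec hJ).comp fun σ => (l₁, Sum.inl σ)).mem_realizations fun σ σ' b => ?_
    refine (D.kernel_vec hJ _ _ b).trans ?_
    rw [hl₁]
    rfl
  let j : Ω ⊕ Ω → F'.E := Sum.elim j₁ j₂
  have hj : F'.IsCovariant α j := by
    rintro (σ | σ)
    · exact hj₁.2.2 σ
    · exact hj₂.2.2 σ
  have hj₁₁ : ∀ σ σ' b, F'.kernel j (Sum.inl σ) (Sum.inl σ') b = K₁ σ σ' b :=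
    fun σ σ' b => (hj₁.1 σ σ' b).symm
  have hj₂₂ : ∀ σ σ' b, F'.kernel j (Sum.inr σ) (Sum.inr σ') b = K₂ σ σ' b :=
    fun σ σ' b => (hj₂.1 σ σ' b).symm
  have hjJ : IsPositiveKernel α (F'.kernel j) := hj.isPositiveKernel <| by
    rintro (σ | σ)
    · exact ⟨‖K₁ σ σ‖, fun b => hj₁₁ σ σ b ▸ (K₁ σ σ).le_opNorm b⟩
    · exact ⟨‖K₂ σ σ‖, fun b => hj₂₂ σ σ b ▸ (K₂ σ σ).le_opNorm b⟩
  let l₂ : Λ := (true, ⟨_, hjJ⟩)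
  have hl₂ : ∀ s s', J (l₂, s) (l₂, s') = F'.kernel j s s' := blockKernel_same _ _
  have hl₁₂ : l₁ ≠ l₂ := fun h => Bool.false_ne_true (congrArg Prod.fst h)
  have hl : ∀ σ σ', J (l₁, Sum.inl σ) (l₁, Sum.inl σ') = J (l₂, Sum.inl σ) (l₂, Sum.inl σ') :=
    fun σ σ' => by
      rw [hl₁, hl₂]
      exact LinearMap.ext fun b => (hj₁₁ σ σ' b).symm
  obtain ⟨Z, hZ, hZip, hZact, hZU⟩ := D.exists_swap_vec hJ
    (m := fun t (σ : Ω) => (cond t l₂ l₁, Sum.inl σ))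
    (by
      rintro (_ | _) σ σ'
      · exact hl σ σ'
      · exact (hl σ σ').symm)
    (by
      rintro (_ | _) σ σ'
      · exact blockKernel_of_ne _ hl₁₂ _ _
      · exact blockKernel_of_ne _ hl₁₂.symm _ _)
  -- Both `i₁` and the coming `i₂` are thus `Z`-images of vectors of the single block `l₂`, where
  -- the inner products are those of `j₁` and `j₂`.
  have hZ₁ : ∀ σ, D.vec hJ 1 (l₁, Sum.inl σ) = Z (D.vec hJ 1 (l₂, Sum.inl σ)) :=
    fun σ => (hZ true σ).symm
  have hip : ∀ s s', ip (A := C.toStarSubalgebra) (Z (D.vec hJ 1 (l₂, s)))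
      (Z (D.vec hJ 1 (l₂, s'))) = ip (j s) (j s') := fun s s' => by
    rw [hZip, D.ip_vec, hl₂, map_one, star_one, one_mul, SCorrespondence.kernel_apply,
      SCorrespondence.act_one]
  refine ⟨fun σ => Z (D.vec hJ 1 (l₂, Sum.inr σ)), ?_, fun σ => ?_⟩
  · have hcov : (D.correspondence hJ).IsCovariant α fun σ => Z (D.vec hJ 1 (l₂, Sum.inr σ)) :=
      fun σ b => by rw [← hZact, ← hZU, D.isCovariant_vec hJ, hZact]
    refine hcov.mem_realizations fun σ σ' b => ?_
    rw [SCorrespondence.kernel_apply, ← hZact, hZip]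
    refine (D.kernel_vec hJ _ _ b).trans ?_
    rw [hl₂, hj₂₂]
  · show ‖D.vec hJ 1 (l₁, Sum.inl σ) - _‖ₑ = _
    rw [hZ₁]
    exact enorm_sub_eq_of_ip C.toStarSubalgebra (hip _ _) (hip _ _) (hip _ _)

end Universal

end Bures

/-! ### Comparison of the infima -/

theorem mainTheorem6 {B : Type u} [CStarAlgebra B]
    {H : Type v} [NormedAddCommGroup H] [InnerProductSpace ℂ H] [CompleteSpace H]
    (C : VonNeumannAlgebra H) (Ω : Type w) (α : B ≃⋆ₐ[ℂ] B) :
    ∃ F : Bures.SCorrespondence.{u, v, max u v w} B C.toStarSubalgebra,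
      Bures.IsVonNeumannModule C F.E ∧
      (∀ K₁ K₂ : Ω → Ω → B →L[ℂ] C.toStarSubalgebra,
        Bures.IsCPDKernel α K₁ → Bures.IsCPDKernel α K₂ →
          F.IsCommon α K₁ K₂ ∧ Bures.buresDist α K₁ K₂ = F.bures α K₁ K₂) ∧
      (∀ K₁ : Ω → Ω → B →L[ℂ] C.toStarSubalgebra, Bures.IsCPDKernel α K₁ →
        ∃ i₁ ∈ F.realizations α K₁,
          ∀ K₂ : Ω → Ω → B →L[ℂ] C.toStarSubalgebra, Bures.IsCPDKernel α K₂ →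
            Bures.buresDist α K₁ K₂ =
              ⨅ (i₂ ∈ F.realizations α K₂) (σ : Ω), ‖i₁ σ - i₂ σ‖ₑ) := by
  obtain ⟨F, hF, hreal⟩ := Bures.exists_universal C Ω α
  have hcommon : ∀ K₁ K₂ : Ω → Ω → B →L[ℂ] C.toStarSubalgebra,
      Bures.IsCPDKernel α K₁ → Bures.IsCPDKernel α K₂ → F.IsCommon α K₁ K₂ :=
    fun K₁ K₂ hK₁ hK₂ => by
      obtain ⟨i₁, hi₁, -⟩ := hreal K₁ hK₁
      obtain ⟨i₂, hi₂, -⟩ := hreal K₂ hK₂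
      exact ⟨⟨i₁, hi₁⟩, ⟨i₂, hi₂⟩⟩
  have hle : ∀ K₁ K₂ : Ω → Ω → B →L[ℂ] C.toStarSubalgebra,
      Bures.IsCPDKernel α K₁ → Bures.IsCPDKernel α K₂ →
        Bures.buresDist α K₁ K₂ ≤ F.bures α K₁ K₂ :=
    fun K₁ K₂ hK₁ hK₂ => iInf₂_le F (hcommon K₁ K₂ hK₁ hK₂)
  -- This closes the chain `β ≤ β_F ≤ (infimum with i₁ fixed) ≤ β`, from which both claims follow.
  have hdist : ∀ K₁ : Ω → Ω → B →L[ℂ] C.toStarSubalgebra, Bures.IsCPDKernel α K₁ →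
      ∃ i₁ ∈ F.realizations α K₁, ∀ K₂ : Ω → Ω → B →L[ℂ] C.toStarSubalgebra,
        (⨅ (i₂ ∈ F.realizations α K₂) (σ : Ω), ‖i₁ σ - i₂ σ‖ₑ) ≤ Bures.buresDist α K₁ K₂ := by
    intro K₁ hK₁
    obtain ⟨i₁, hi₁, h⟩ := hreal K₁ hK₁
    refine ⟨i₁, hi₁, fun K₂ => le_iInf₂ fun F' _ => le_iInf₂ fun j₁ hj₁ => le_iInf₂ fun j₂ hj₂ => ?_⟩
    obtain ⟨i₂, hi₂, hi⟩ := h K₂ F' j₁ hj₁ j₂ hj₂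
    refine (iInf₂_le i₂ hi₂).trans (le_iInf fun σ => (iInf_le _ σ).trans (hi σ).le)
  refine ⟨F, hF, fun K₁ K₂ hK₁ hK₂ => ⟨hcommon K₁ K₂ hK₁ hK₂, (hle K₁ K₂ hK₁ hK₂).antisymm ?_⟩,
    fun K₁ hK₁ => ?_⟩
  · obtain ⟨i₁, hi₁, h⟩ := hdist K₁ hK₁
    exact (iInf₂_le i₁ hi₁).trans (h K₂)
  · obtain ⟨i₁, hi₁, h⟩ := hdist K₁ hK₁
    exact ⟨i₁, hi₁, fun K₂ hK₂ =>
      ((hle K₁ K₂ hK₁ hK₂).trans (iInf₂_le i₁ hi₁)).antisymm (h K₂)⟩
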